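/- Let $\mathcal C$ be the class of unit loops: Lipschitz closed curves $\gamma:[0,1]\to\mathbb R^3$, $\gamma(0)=\gamma(1)$, parametrized by arclength ($|\gamma'|=1$ almost everywhere), whose image contains the origin and satisfies $\mathscr H^1(\gamma([0,1]))=1$, where $\mathscr H^1$ is one-dimensional Hausdorff measure. Self-intersections are allowed a priori. For $x,y,z\in\mathbb R^3$ let $R(x,y,z)\in(0,\infty]$ be the radius of the circle through $x,y,z$, with $R=\infty$ if the points are collinear, and for $p>0$ define the integral Menger curvature $$\mathscr M_p(\gamma)=\int_\gamma\int_\gamma\int_\gamma\frac{d\mathscr H^1(x)\,d\mathscr H^1(y)\,d\mathscr H^1(z)}{R(x,y,z)^p}\in[0,\infty],\qquad \gamma\in\mathcal C,$$ where the integrals are taken over the image of $\gamma$. Then there exists $p_0>0$ such that for every real $p\ge p_0$, every minimizer $\gamma$ of $\mathscr M_p$ in $\mathcal C$ (that is, $\gamma\in\mathcal C$ and $\mathscr M_p(\gamma)\le\mathscr M_p(\beta)$ for all $\beta\in\mathcal C$) is an unknot: $\gamma$ is injective on $[0,1)$ and its image is ambient isotopic in $\mathbb R^3$ to a round circle. 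-/

import Mathlib

open Set MeasureTheory
open scoped ENNReal

/-- Euclidean three-space. -/
abbrev E3 : Type := EuclideanSpace ℝ (Fin 3)

/-- The trace (image) of a curve parametrized on `[0, 1]`; values of `γ` outside `[0, 1]` play
no role. -/
def trace (γ : ℝ → E3) : Set E3 := γ '' Icc (0 : ℝ) 1

/-- A unit loop: a closed Lipschitz curve on `[0, 1]` parametrized by arclength (`|γ'| = 1` almost
everywhere), through the origin, whose trace has one-dimensional Hausdorff measure `1`.
Unit loops may a priori have self-intersections. -/
structure IsUnitLoop (γ : ℝ → E3) : Prop where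
  lipschitz : ∃ K : NNReal, LipschitzOnWith K γ (Icc 0 1)
  unit_speed : ∀ᵐ t ∂(volume.restrict (Ioo (0 : ℝ) 1)), ‖deriv γ t‖ = 1
  closed : γ 0 = γ 1
  origin_mem : (0 : E3) ∈ trace γ
  hausdorff_eq_one : Measure.hausdorffMeasure 1 (trace γ) = 1

open Classical in
/-- The radius of the circle through `x`, `y`, `z`, with value `∞` if the points are collinear (the
triples with two equal points form a null set for the energy below). -/
noncomputable def circumR (x y z : E3) : ℝ≥0∞ :=
  if h : AffineIndependent ℝ ![x, y, z] then
    ENNReal.ofReal (Affine.Simplex.circumradius (⟨![x, y, z], h⟩ : Affine.Simplex ℝ E3 2))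
  else ⊤

/-- Integral Menger curvature: the triple integral of `1 / R(x, y, z) ^ p` over the trace of `γ`
with respect to one-dimensional Hausdorff measure. -/
noncomputable def mengerEnergy (p : ℝ) (γ : ℝ → E3) : ℝ≥0∞ :=
  ∫⁻ x in trace γ, ∫⁻ y in trace γ, ∫⁻ z in trace γ, (circumR x y z ^ p)⁻¹
    ∂(Measure.hausdorffMeasure 1) ∂(Measure.hausdorffMeasure 1) ∂(Measure.hausdorffMeasure 1)

/-- `γ` is a minimizer of integral Menger curvature in the class of all unit loops. -/
def IsMengerMinimizer (p : ℝ) (γ : ℝ → E3) : Prop :=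
  IsUnitLoop γ ∧ ∀ β : ℝ → E3, IsUnitLoop β → mengerEnergy p γ ≤ mengerEnergy p β

/-- Two subsets of space are ambient isotopic. -/
def AmbientIsotopic (A B : Set E3) : Prop :=
  ∃ H : unitInterval → (E3 ≃ₜ E3),
    Continuous (fun q : unitInterval × E3 => H q.1 q.2) ∧
    (∀ x, H 0 x = x) ∧ H 1 '' A = B

/-- The standard round unit circle in the horizontal coordinate plane. -/
def roundCircle : Set E3 := {x | x 0 ^ 2 + x 1 ^ 2 = 1 ∧ x 2 = 0}

/-- A closed curve on `[0, 1]` is an unknot if it is simple and its trace is ambient isotopic to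
a round circle. -/
def IsUnknot (γ : ℝ → E3) : Prop :=
  InjOn γ (Ico (0 : ℝ) 1) ∧ AmbientIsotopic (trace γ) roundCircle

/-! Argue by contradiction and compactness, letting the exponent tend to infinity along a sequence
of minimizers that are not unknots.

The circle of length one has Menger curvature at most 2π on every triple, so a minimizer has energy
at most (2π)^p. The periodic extension of a unit loop is 1-Lipschitz, so a small ball of radius ρ
about a point of the trace carries length at least ρ, and the curvature κ = 1/R of three separated
points is stable under small displacements (`kap_perturb`). One triple of large curvature therefore
forces large energy (`kap_rpow_mul_le`). This yields two pointwise bounds for triples at mutual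
distance at least d: κ ≤ 26 d^(-1/4) as soon as p ≥ 24 (`kap_le_of_energy`), and κ ≤ 2π(1 + ε) once
p is large in terms of ε and d (`exists_kap_le_of_energy`).

The first bound controls directions: any two secants of a piece of diameter D make an angle with
sine O(D^(3/4)). Since the trace has the full length 1, a positive length of parameters cannot be
retraced, so the curve cannot fold and moves in one direction at speed at least 1 - O(D^(3/2))
(`IsLoop.isFlat`). This flatness is uniform along the sequence and survives pointwise limits, where
length alone could drop.

The limit curve is closed, 1-Lipschitz, flat and has κ ≤ 2π. Its differences of step h then satisfy
‖Δ²‖² ≤ (4π² + o(1)) h⁴ and ‖Δ‖² ≥ (1 - o(1)) h². By Parseval this is the equality case of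
Wirtinger's inequality, so only the frequencies 0 and ±1 occur, and unit speed makes the limit a
round circle (`IsFlat.eq_circle`).

Finally, flatness upgrades uniform closeness to closeness in Lipschitz norm
(`IsFlat.lipschitz_sub`). A late curve of the sequence is thus the circle moved by a displacement of
small Lipschitz constant. Such a displacement preserves injectivity, extends to space, and generates
an ambient isotopy (`isUnknot_of_close`), which is the contradiction. -/

/-! ### The cross product on Euclidean three-space -/

/-- The cross product of two vectors of Euclidean three-space. -/
noncomputable def cr (u v : E3) : E3 :=
  !₂[u 1 * v 2 - u 2 * v 1, u 2 * v 0 - u 0 * v 2, u 0 * v 1 - u 1 * v 0]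

theorem cr_apply_zero (u v : E3) : cr u v 0 = u 1 * v 2 - u 2 * v 1 := rfl
theorem cr_apply_one (u v : E3) : cr u v 1 = u 2 * v 0 - u 0 * v 2 := rfl
theorem cr_apply_two (u v : E3) : cr u v 2 = u 0 * v 1 - u 1 * v 0 := rfl

theorem E3.ext {u v : E3} (h0 : u 0 = v 0) (h1 : u 1 = v 1) (h2 : u 2 = v 2) : u = v := by
  ext i
  fin_cases i <;> assumption

theorem E3.norm_sq (u : E3) : ‖u‖ ^ 2 = u 0 ^ 2 + u 1 ^ 2 + u 2 ^ 2 := by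
  simp [EuclideanSpace.norm_sq_eq, Fin.sum_univ_three]

theorem E3.inner_eq (u v : E3) : inner ℝ u v = u 0 * v 0 + u 1 * v 1 + u 2 * v 2 := by
  simp [PiLp.inner_apply, Fin.sum_univ_three, mul_comm]

theorem cr_add_left (u u' v : E3) : cr (u + u') v = cr u v + cr u' v := by
  apply E3.ext <;> simp [cr_apply_zero, cr_apply_one, cr_apply_two] <;> ring

theorem cr_add_right (u v v' : E3) : cr u (v + v') = cr u v + cr u v' := by
  apply E3.ext <;> simp [cr_apply_zero, cr_apply_one, cr_apply_two] <;> ring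

theorem cr_sub_right (u v v' : E3) : cr u (v - v') = cr u v - cr u v' := by
  apply E3.ext <;> simp [cr_apply_zero, cr_apply_one, cr_apply_two] <;> ring

theorem cr_smul_left (c : ℝ) (u v : E3) : cr (c • u) v = c • cr u v := by
  apply E3.ext <;> simp [cr_apply_zero, cr_apply_one, cr_apply_two] <;> ring

theorem cr_smul_right (c : ℝ) (u v : E3) : cr u (c • v) = c • cr u v := by
  apply E3.ext <;> simp [cr_apply_zero, cr_apply_one, cr_apply_two] <;> ring

theorem cr_self (u : E3) : cr u u = 0 := by
  apply E3.ext <;> simp [cr_apply_zero, cr_apply_one, cr_apply_two] <;> ring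

theorem cr_anticomm (u v : E3) : cr u v = -cr v u := by
  apply E3.ext <;> simp [cr_apply_zero, cr_apply_one, cr_apply_two] <;> ring

theorem norm_cr_comm (u v : E3) : ‖cr u v‖ = ‖cr v u‖ := by
  rw [cr_anticomm, norm_neg]

/-- Lagrange's identity. -/
theorem norm_cr_sq (u v : E3) : ‖cr u v‖ ^ 2 = ‖u‖ ^ 2 * ‖v‖ ^ 2 - inner ℝ u v ^ 2 := by
  rw [E3.norm_sq, E3.norm_sq, E3.norm_sq, E3.inner_eq, cr_apply_zero, cr_apply_one, cr_apply_two]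
  ring

theorem norm_cr_le (u v : E3) : ‖cr u v‖ ≤ ‖u‖ * ‖v‖ := by
  apply le_of_sq_le_sq _ (by positivity)
  rw [norm_cr_sq, mul_pow]
  nlinarith [sq_nonneg (inner ℝ u v)]

theorem inner_cr_self_left (u v : E3) : inner ℝ (cr u v) u = 0 := by
  rw [E3.inner_eq, cr_apply_zero, cr_apply_one, cr_apply_two]; ring

theorem inner_cr_self_right (u v : E3) : inner ℝ (cr u v) v = 0 := by
  rw [E3.inner_eq, cr_apply_zero, cr_apply_one, cr_apply_two]; ring

theorem continuous_cr : Continuous fun q : E3 × E3 => cr q.1 q.2 := by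
  unfold cr
  refine (PiLp.continuous_toLp 2 _).comp (continuous_pi fun i => ?_)
  fin_cases i <;> simp <;> fun_prop

/-! ### Ambient isotopies -/

theorem AmbientIsotopic.trans {A B C : Set E3} (h : AmbientIsotopic A B)
    (h' : AmbientIsotopic B C) : AmbientIsotopic A C := by
  obtain ⟨H, hc, h0, h1⟩ := h
  obtain ⟨K, kc, k0, k1⟩ := h'
  refine ⟨fun t => (H t).trans (K t), ?_, fun x => ?_, ?_⟩
  · exact kc.comp (continuous_fst.prodMk hc)
  · simp [h0, k0]
  · rw [← k1, ← h1, image_image]; rfl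

/-- The reversed isotopy is t ↦ H_{1-t} ∘ H_1⁻¹. Only the inverse at the single time 1 occurs, so
joint continuity of the inverses is not needed. -/
theorem AmbientIsotopic.symm {A B : Set E3} (h : AmbientIsotopic A B) : AmbientIsotopic B A := by
  obtain ⟨H, hc, h0, h1⟩ := h
  refine ⟨fun t => (H 1).symm.trans (H (unitInterval.symm t)), ?_, fun x => ?_, ?_⟩
  · exact hc.comp ((unitInterval.continuous_symm.comp continuous_fst).prodMk
      ((H 1).symm.continuous.comp continuous_snd))
  · simp
  · rw [← h1, image_image]
    simp [h0]

/-- Every stage x ↦ x + tΦ(x) is a perturbation of the identity of Lipschitz constant at most K < 1,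
hence a homeomorphism of the whole space. -/
theorem ambientIsotopic_of_lipschitzWith {Φ : E3 → E3} {K : NNReal} (hK : K < 1)
    (hΦ : LipschitzWith K Φ) (A : Set E3) : AmbientIsotopic A ((fun x => x + Φ x) '' A) := by
  have key : ∀ t : unitInterval, ApproximatesLinearOn (fun x => x + (t : ℝ) • Φ x)
      ((ContinuousLinearEquiv.refl ℝ E3 : E3 ≃L[ℝ] E3) : E3 →L[ℝ] E3) univ K := by
    intro t x _ y _
    have h1 : x + (t : ℝ) • Φ x - (y + (t : ℝ) • Φ y) -
        ((ContinuousLinearEquiv.refl ℝ E3 : E3 ≃L[ℝ] E3) : E3 →L[ℝ] E3) (x - y) =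
        (t : ℝ) • (Φ x - Φ y) := by
      simp only [ContinuousLinearEquiv.coe_refl, ContinuousLinearMap.coe_id', id_eq]
      module
    rw [h1, norm_smul, Real.norm_of_nonneg t.2.1]
    have h2 := hΦ.dist_le_mul x y
    rw [dist_eq_norm, dist_eq_norm] at h2
    exact (mul_le_of_le_one_left (norm_nonneg _) t.2.2).trans h2
  have hc : Subsingleton E3 ∨ K < ‖((ContinuousLinearEquiv.refl ℝ E3).symm : E3 →L[ℝ] E3)‖₊⁻¹ := by
    right
    simpa using hK
  refine ⟨fun t => (key t).toHomeomorph _ hc, ?_, fun x => ?_, ?_⟩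
  · change Continuous fun q : unitInterval × E3 => q.2 + (q.1 : ℝ) • Φ q.2
    have := hΦ.continuous
    fun_prop
  · change x + ((0 : unitInterval) : ℝ) • Φ x = x
    simp
  · change (fun x => x + ((1 : unitInterval) : ℝ) • Φ x) '' A = _
    simp

/-- A set is ambient isotopic to its image under a displacement with small Lipschitz constant. -/
theorem ambientIsotopic_of_lipschitzOnWith {Φ : E3 → E3} {K : NNReal} {A : Set E3}
    (hK : lipschitzExtensionConstant E3 * K < 1) (hΦ : LipschitzOnWith K Φ A) :
    AmbientIsotopic A ((fun x => x + Φ x) '' A) := by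
  obtain ⟨Ψ, hΨ, he⟩ := hΦ.extend_finite_dimension
  have : (fun x => x + Φ x) '' A = (fun x => x + Ψ x) '' A :=
    image_congr fun x hx => by rw [he hx]
  rw [this]
  exact ambientIsotopic_of_lipschitzWith hK hΨ A

theorem ambientIsotopic_affine (q : E3) {c : ℝ} (hc : 0 < c) (A : Set E3) :
    AmbientIsotopic A ((fun x => c • (x - q)) '' A) := by
  have hpos : ∀ t : unitInterval, 1 - (t : ℝ) + t * c ≠ 0 := by
    intro t
    have h0 := t.2.1
    have h1 := t.2.2
    rcases h0.eq_or_lt with h | h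
    · rw [← h]; norm_num
    · have := mul_pos h hc
      linarith
  refine ⟨fun t => (Homeomorph.addRight (-((t : ℝ) • q))).trans
    (Homeomorph.smulOfNeZero _ (hpos t)), ?_, fun x => ?_, ?_⟩
  · change Continuous fun r : unitInterval × E3 =>
      (1 - (r.1 : ℝ) + r.1 * c) • (r.2 + -((r.1 : ℝ) • q))
    fun_prop
  · simp
  · apply image_congr
    intro x _
    simp [sub_eq_add_neg]

/-- The unit circle around the origin in the plane orthogonal to `n`. -/
def circleN (n : E3) : Set E3 := {x | ‖x‖ = 1 ∧ inner ℝ n x = 0}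

theorem circleN_neg (n : E3) : circleN (-n) = circleN n := by
  simp [circleN, inner_neg_left]

theorem roundCircle_eq : roundCircle = circleN (EuclideanSpace.single 2 1) := by
  ext x
  have h : ‖x‖ = 1 ↔ ‖x‖ ^ 2 = 1 := by
    rw [pow_eq_one_iff_of_nonneg (norm_nonneg _) two_ne_zero]
  simp only [roundCircle, circleN, mem_ofPred_eq, h, E3.norm_sq, EuclideanSpace.inner_single_left]
  constructor
  · rintro ⟨h1, h2⟩; simp [h1, h2]
  · rintro ⟨h1, h2⟩
    have h2 : x 2 = 0 := by simpa using h2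
    rw [h2] at h1
    exact ⟨by simpa using h1, h2⟩

theorem image_circleN (L : E3 ≃ₗᵢ[ℝ] E3) (n : E3) : L '' circleN n = circleN (L n) := by
  ext y
  constructor
  · rintro ⟨x, ⟨h1, h2⟩, rfl⟩
    exact ⟨by simpa using h1, by simpa using h2⟩
  · rintro ⟨h1, h2⟩
    refine ⟨L.symm y, ⟨by simpa using h1, ?_⟩, by simp⟩
    rw [← L.inner_map_map]; simpa using h2

/-- A product of two reflections is a rotation: reflect in the plane orthogonal to n, then in the
plane orthogonal to n + tm. At t = 0 this is the identity; at t = 1 it sends n to m. The sign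
hypothesis keeps n + tm away from 0, and replacing n by -n achieves it in general. -/
theorem ambientIsotopic_circleN_of_inner_nonneg {n m : E3} (hn : ‖n‖ = 1) (hm : ‖m‖ = 1)
    (h : 0 ≤ inner ℝ n m) : AmbientIsotopic (circleN n) (circleN m) := by
  have hne : ∀ t : unitInterval, n + (t : ℝ) • m ≠ 0 := by
    intro t h0
    have : inner ℝ n (n + (t : ℝ) • m) = 0 := by rw [h0, inner_zero_right]
    rw [inner_add_right, inner_smul_right, real_inner_self_eq_norm_sq, hn] at this
    have := mul_nonneg t.2.1 h
    linarith
  let ρ : E3 → E3 ≃ₗᵢ[ℝ] E3 := fun v => Submodule.reflection (Submodule.span ℝ {v})ᗮ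
  have hρ : ∀ v x, ρ v x = x - (2 * (inner ℝ v x / ‖v‖ ^ 2)) • v := by
    intro v x
    simp only [ρ, Submodule.reflection_orthogonal_apply, Submodule.reflection_singleton_apply]
    simp only [RCLike.ofReal_real_eq_id, id_eq]
    module
  refine ⟨fun t => ((ρ n).trans (ρ (n + (t : ℝ) • m))).toHomeomorph, ?_, fun x => ?_, ?_⟩
  · have : ∀ q : unitInterval × E3, ((ρ n).trans (ρ (n + (q.1 : ℝ) • m))).toHomeomorph q.2 =
        ρ n q.2 - (2 * (inner ℝ (n + (q.1 : ℝ) • m) (ρ n q.2) / ‖n + (q.1 : ℝ) • m‖ ^ 2)) •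
          (n + (q.1 : ℝ) • m) := fun q => hρ _ _
    simp only [this]
    have hc := (ρ n).continuous
    have hd : ∀ q : unitInterval × E3, ‖n + (q.1 : ℝ) • m‖ ^ 2 ≠ 0 := fun q => by
      have := hne q.1
      positivity
    fun_prop (disch := exact hd)
  · change ρ (n + ((0 : unitInterval) : ℝ) • m) (ρ n x) = x
    simp [ρ]
  · change ((ρ n).trans (ρ (n + ((1 : unitInterval) : ℝ) • m))) '' circleN n = circleN m
    rw [image_circleN]
    congr 1
    change ρ (n + ((1 : unitInterval) : ℝ) • m) (ρ n n) = m
    have h1 : ρ n n = -n := by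
      rw [hρ, real_inner_self_eq_norm_sq, hn]; norm_num
      module
    have hq : ‖n + m‖ ^ 2 = 2 * (1 + inner ℝ n m) := by
      rw [norm_add_sq_real, hn, hm]; ring
    have hq' : 1 + inner ℝ n m ≠ 0 := by positivity
    have hi : inner ℝ (n + m) (-n) = -(1 + inner ℝ n m) := by
      rw [inner_neg_right, inner_add_left, real_inner_self_eq_norm_sq, hn, real_inner_comm]
      norm_num
    have hc : 2 * (-(1 + inner ℝ n m) / (2 * (1 + inner ℝ n m))) = -1 := by
      field_simp
    have h2 : n + ((1 : unitInterval) : ℝ) • m = n + m := by simp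
    rw [h1, h2, hρ, hi, hq, hc]
    module

theorem ambientIsotopic_circleN_roundCircle {n : E3} (hn : ‖n‖ = 1) :
    AmbientIsotopic (circleN n) roundCircle := by
  rw [roundCircle_eq]
  have he : ‖(EuclideanSpace.single 2 1 : E3)‖ = 1 := by simp
  rcases le_total 0 (inner ℝ n (EuclideanSpace.single 2 1 : E3)) with h | h
  · exact ambientIsotopic_circleN_of_inner_nonneg hn he h
  · rw [← circleN_neg]
    exact ambientIsotopic_circleN_of_inner_nonneg (by rwa [norm_neg]) he
      (by rw [inner_neg_left]; linarith)

theorem range_cos_sin_eq_circleN {a b : E3} (ha : ‖a‖ = 1) (hb : ‖b‖ = 1) (hab : inner ℝ a b = 0) :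
    (range fun t : ℝ => Real.cos t • a + Real.sin t • b) = circleN (cr a b) := by
  have hn : ‖cr a b‖ = 1 := by
    have := norm_cr_sq a b
    rw [ha, hb, hab] at this
    rw [← pow_eq_one_iff_of_nonneg (norm_nonneg _) two_ne_zero, this]; norm_num
  have hon : Orthonormal ℝ ![a, b, cr a b] := by
    rw [orthonormal_iff_ite]
    have h1 : inner ℝ a (cr a b) = 0 := by rw [real_inner_comm]; exact inner_cr_self_left a b
    have h2 : inner ℝ b (cr a b) = 0 := by rw [real_inner_comm]; exact inner_cr_self_right a b
    have h3 : inner ℝ b a = 0 := by rw [real_inner_comm]; exact hab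
    intro i j
    fin_cases i <;> fin_cases j <;>
      simp [ha, hb, hn, hab, h1, h2, h3, inner_cr_self_left, inner_cr_self_right]
  let B := basisOfOrthonormalOfCardEqFinrank hon (by simp)
  let O := B.toOrthonormalBasis (by simpa [B] using hon)
  have hO : ∀ x : E3, x = inner ℝ a x • a + inner ℝ b x • b + inner ℝ (cr a b) x • cr a b := by
    intro x
    conv_lhs => rw [← O.sum_repr' x]
    simp [Fin.sum_univ_three, O, B]
  ext x
  constructor
  · rintro ⟨t, rfl⟩
    constructor
    · rw [← pow_eq_one_iff_of_nonneg (norm_nonneg _) two_ne_zero, norm_add_sq_real, norm_smul,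
        norm_smul, inner_smul_left, inner_smul_right, hab, ha, hb]
      simp
    · rw [inner_add_right, inner_smul_right, inner_smul_right, inner_cr_self_left,
        inner_cr_self_right]
      simp
  · rintro ⟨h1, h2⟩
    have hx := hO x
    rw [h2, zero_smul, add_zero] at hx
    have h3 : inner ℝ a x ^ 2 + inner ℝ b x ^ 2 = 1 := by
      have : ‖x‖ ^ 2 = 1 := by rw [h1]; norm_num
      rw [hx, norm_add_sq_real, norm_smul, norm_smul, inner_smul_left, inner_smul_right, hab, ha,
        hb] at this
      simpa using this
    let z : ℂ := ⟨inner ℝ a x, inner ℝ b x⟩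
    have hz : ‖z‖ = 1 := by
      rw [← pow_eq_one_iff_of_nonneg (norm_nonneg _) two_ne_zero, Complex.sq_norm,
        Complex.normSq_mk]
      linarith
    refine ⟨z.arg, ?_⟩
    have hz0 : z ≠ 0 := by
      intro h; rw [h, norm_zero] at hz; norm_num at hz
    simp only
    rw [Complex.cos_arg hz0, Complex.sin_arg, hz, div_one, div_one]
    exact hx.symm

theorem ambientIsotopic_roundCircle_of_range {q a b : E3} {r : ℝ} (hr : 0 < r) (ha : ‖a‖ = r)
    (hb : ‖b‖ = r) (hab : inner ℝ a b = 0) :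
    AmbientIsotopic (range fun t : ℝ => q + Real.cos t • a + Real.sin t • b) roundCircle := by
  refine (ambientIsotopic_affine q (inv_pos.2 hr) _).trans ?_
  have h1 : (fun x => r⁻¹ • (x - q)) '' (range fun t : ℝ => q + Real.cos t • a + Real.sin t • b) =
      range fun t : ℝ => Real.cos t • (r⁻¹ • a) + Real.sin t • (r⁻¹ • b) := by
    rw [← range_comp]
    congr 1
    ext1 t
    simp only [Function.comp]
    module
  have hn : ∀ v : E3, ‖v‖ = r → ‖r⁻¹ • v‖ = 1 := by
    intro v hv
    rw [norm_smul, hv, Real.norm_of_nonneg (by positivity), inv_mul_cancel₀ hr.ne']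
  have hab' : inner ℝ (r⁻¹ • a) (r⁻¹ • b) = 0 := by
    rw [inner_smul_left, inner_smul_right, hab]; simp
  rw [h1, range_cos_sin_eq_circleN (hn a ha) (hn b hb) hab']
  apply ambientIsotopic_circleN_roundCircle
  have := norm_cr_sq (r⁻¹ • a) (r⁻¹ • b)
  rw [hn a ha, hn b hb, hab'] at this
  rw [← pow_eq_one_iff_of_nonneg (norm_nonneg _) two_ne_zero, this]; norm_num

/-! ### The Menger curvature of a triple of points -/

/-- The Menger curvature of three points: the inverse of the radius of their circumcircle, and zero
for degenerate triples. -/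
noncomputable def kap (x y z : E3) : ℝ :=
  2 * ‖cr (y - x) (z - x)‖ / (‖y - x‖ * ‖z - x‖ * ‖z - y‖)

theorem kap_nonneg (x y z : E3) : 0 ≤ kap x y z := by unfold kap; positivity

theorem cr_eq_zero_of_not_affineIndependent {x y z : E3} (h : ¬AffineIndependent ℝ ![x, y, z]) :
    cr (y - x) (z - x) = 0 := by
  rw [affineIndependent_iff_not_collinear_set, not_not,
    collinear_iff_of_mem (p₀ := x) (by simp)] at h
  obtain ⟨v, hv⟩ := h
  obtain ⟨r, hr⟩ := hv y (by simp)
  obtain ⟨s, hs⟩ := hv z (by simp)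
  rw [hr, hs]
  simp [cr_smul_left, cr_smul_right, cr_self]

/-- The circumcenter is written in barycentric coordinates. Equality of its distances to the
vertices gives two linear equations for the weights, and eliminating the weights leaves the
classical 4 · (twice the area)² · R² = product of the squared sides. -/
theorem circumradius_mul_kap {x y z : E3} (h : AffineIndependent ℝ ![x, y, z]) :
    Affine.Simplex.circumradius (⟨![x, y, z], h⟩ : Affine.Simplex ℝ E3 2) * kap x y z = 1 := by
  set T : Affine.Simplex ℝ E3 2 := ⟨![x, y, z], h⟩ with hT
  obtain ⟨w, hw1, hw⟩ := eq_affineCombination_of_mem_affineSpan_of_fintype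
    T.circumcenter_mem_affineSpan
  rw [Finset.affineCombination_eq_linear_combination _ _ _ hw1] at hw
  replace hw1 : w 0 + w 1 + w 2 = 1 := (Fin.sum_univ_three w).symm.trans hw1
  replace hw : T.circumcenter = w 0 • x + w 1 • y + w 2 • z := hw.trans (Fin.sum_univ_three _)
  set R := T.circumradius
  set u := y - x with hu
  set v := z - x with hv
  have d0 : ‖T.circumcenter - x‖ = R := by
    rw [← dist_eq_norm, dist_comm]; exact T.dist_circumcenter_eq_circumradius 0
  have d1 : ‖T.circumcenter - y‖ = R := by
    rw [← dist_eq_norm, dist_comm]; exact T.dist_circumcenter_eq_circumradius 1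
  have d2 : ‖T.circumcenter - z‖ = R := by
    rw [← dist_eq_norm, dist_comm]; exact T.dist_circumcenter_eq_circumradius 2
  have e0 : T.circumcenter - x = w 1 • u + w 2 • v := by
    have : w 0 = 1 - w 1 - w 2 := by linarith
    rw [hw, this, hu, hv]; module
  have e1 : T.circumcenter - y = (w 1 • u + w 2 • v) - u := by rw [← e0, hu]; abel
  have e2 : T.circumcenter - z = (w 1 • u + w 2 • v) - v := by rw [← e0, hv]; abel
  have hinner : ∀ t, inner ℝ (w 1 • u + w 2 • v) t = w 1 * inner ℝ u t + w 2 * inner ℝ v t := by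
    intro t; rw [inner_add_left, real_inner_smul_left, real_inner_smul_left]
  have f0 : w 1 ^ 2 * ‖u‖ ^ 2 + 2 * w 1 * w 2 * inner ℝ u v + w 2 ^ 2 * ‖v‖ ^ 2 = R ^ 2 := by
    rw [← d0, e0, norm_add_sq_real, norm_smul, norm_smul, real_inner_smul_left,
      real_inner_smul_right, mul_pow, mul_pow, Real.norm_eq_abs, Real.norm_eq_abs, sq_abs, sq_abs]
    ring
  have f1 : w 1 * ‖u‖ ^ 2 + w 2 * inner ℝ u v = ‖u‖ ^ 2 / 2 := by
    have : ‖(w 1 • u + w 2 • v) - u‖ ^ 2 = ‖w 1 • u + w 2 • v‖ ^ 2 := by rw [← e1, ← e0, d0, d1]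
    rw [norm_sub_sq_real, hinner, real_inner_self_eq_norm_sq, real_inner_comm u v] at this
    linarith
  have f2 : w 1 * inner ℝ u v + w 2 * ‖v‖ ^ 2 = ‖v‖ ^ 2 / 2 := by
    have : ‖(w 1 • u + w 2 • v) - v‖ ^ 2 = ‖w 1 • u + w 2 • v‖ ^ 2 := by rw [← e2, ← e0, d0, d2]
    rw [norm_sub_sq_real, hinner, real_inner_self_eq_norm_sq] at this
    linarith
  have hzy : ‖z - y‖ ^ 2 = ‖u‖ ^ 2 + ‖v‖ ^ 2 - 2 * inner ℝ u v := by
    have : z - y = v - u := by rw [hu, hv]; abel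
    rw [this, norm_sub_sq_real, real_inner_comm]; ring
  have hinj : Function.Injective ![x, y, z] := h.injective
  have n0 : ‖u‖ ≠ 0 := by
    rw [norm_ne_zero_iff, hu, sub_ne_zero]
    exact fun e => absurd (hinj (a₁ := 1) (a₂ := 0) e) (by decide)
  have n1 : ‖v‖ ≠ 0 := by
    rw [norm_ne_zero_iff, hv, sub_ne_zero]
    exact fun e => absurd (hinj (a₁ := 2) (a₂ := 0) e) (by decide)
  have n2 : ‖z - y‖ ≠ 0 := by
    rw [norm_ne_zero_iff, sub_ne_zero]
    exact fun e => absurd (hinj (a₁ := 2) (a₂ := 1) e) (by decide)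
  have key : 4 * ‖cr u v‖ ^ 2 * R ^ 2 = ‖u‖ ^ 2 * ‖v‖ ^ 2 * ‖z - y‖ ^ 2 := by
    rw [norm_cr_sq, hzy, ← f0]
    linear_combination (4 * (‖u‖ ^ 2 * ‖v‖ ^ 2 - inner ℝ u v ^ 2) * w 1 + 2 * ‖u‖ ^ 2 * ‖v‖ ^ 2
      - 2 * ‖v‖ ^ 2 * inner ℝ u v) * f1 + (4 * (‖u‖ ^ 2 * ‖v‖ ^ 2 - inner ℝ u v ^ 2) * w 2
      - 2 * ‖u‖ ^ 2 * inner ℝ u v + 2 * ‖u‖ ^ 2 * ‖v‖ ^ 2) * f2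
  have hR : 0 ≤ R := T.circumradius_nonneg
  rw [← pow_eq_one_iff_of_nonneg (mul_nonneg hR (kap_nonneg _ _ _)) two_ne_zero, kap, ← hu, ← hv,
    mul_pow, div_pow, mul_pow, mul_pow, mul_pow]
  field_simp
  linarith

theorem circumR_rpow_inv (x y z : E3) {p : ℝ} (hp : 0 < p) :
    (circumR x y z ^ p)⁻¹ = ENNReal.ofReal (kap x y z ^ p) := by
  unfold circumR
  split_ifs with h
  · have h1 := circumradius_mul_kap h
    set R := Affine.Simplex.circumradius (⟨![x, y, z], h⟩ : Affine.Simplex ℝ E3 2)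
    have hR : 0 < R := Affine.Simplex.circumradius_pos _
    have h2 : kap x y z = R⁻¹ := eq_inv_of_mul_eq_one_right h1
    rw [h2, ENNReal.ofReal_rpow_of_pos hR, ← ENNReal.ofReal_inv_of_pos (by positivity),
      Real.inv_rpow hR.le]
  · have : kap x y z = 0 := by
      rw [kap, cr_eq_zero_of_not_affineIndependent h]; simp
    rw [this, ENNReal.top_rpow_of_pos hp, Real.zero_rpow hp.ne']
    simp

theorem kap_mul_sides (x y z : E3) (h1 : y ≠ x) (h2 : z ≠ x) (h3 : z ≠ y) :
    kap x y z * (‖y - x‖ * ‖z - x‖ * ‖z - y‖) = 2 * ‖cr (y - x) (z - x)‖ := by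
  have n1 := norm_ne_zero_iff.2 (sub_ne_zero.2 h1)
  have n2 := norm_ne_zero_iff.2 (sub_ne_zero.2 h2)
  have n3 := norm_ne_zero_iff.2 (sub_ne_zero.2 h3)
  rw [kap]
  field_simp

/-! ### Stability of the Menger curvature and lower bounds for the energy -/

theorem norm_add_le_mul_of_le {E : Type*} [NormedAddCommGroup E] {a e : E} {d η ρ : ℝ}
    (hη : 0 ≤ η) (hd : d ≤ ‖a‖) (he : ‖e‖ ≤ 2 * ρ) (hρ : 2 * ρ ≤ η * d) :
    ‖a + e‖ ≤ (1 + η) * ‖a‖ := by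
  have := norm_add_le a e
  nlinarith

/-- Law of sines: the curvature is twice the sine of the angle at x divided by the opposite side. -/
theorem kap_mul_le_two {x y z : E3} {d : ℝ} (h : d ≤ ‖z - y‖) : kap x y z * d ≤ 2 := by
  refine (mul_le_mul_of_nonneg_left h (kap_nonneg x y z)).trans ?_
  rw [kap, div_mul_eq_mul_div]
  apply div_le_of_le_mul₀ (by positivity) zero_le_two
  have := mul_le_mul_of_nonneg_right (norm_cr_le (y - x) (z - x)) (norm_nonneg (z - y))
  linarith

/-- Moving the three vertices by a small amount does not decrease the Menger curvature much. -/
theorem kap_perturb {x y z x' y' z' : E3} {d η ρ : ℝ} (hd : 0 < d) (hη : 0 < η) (hη1 : η < 1)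
    (hxy : d ≤ ‖y - x‖) (hxz : d ≤ ‖z - x‖) (hyz : d ≤ ‖z - y‖)
    (hρ : ρ = η * kap x y z * d ^ 2 / 12)
    (hx : ‖x' - x‖ ≤ ρ) (hy : ‖y' - y‖ ≤ ρ) (hz : ‖z' - z‖ ≤ ρ) :
    kap x y z * ((1 - η) / (1 + η) ^ 3) ≤ kap x' y' z' := by
  have hne : ∀ {a b : E3}, d ≤ ‖a - b‖ → a ≠ b := by
    rintro a b h rfl
    simp at h; linarith
  have hk0 := kap_nonneg x y z
  have hks := kap_mul_sides x y z (hne hxy) (hne hxz) (hne hyz)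
  set κ := kap x y z with hκ
  set u := y - x with hu
  set v := z - x with hv
  have hκd : κ * d ≤ 2 := kap_mul_le_two hyz
  have hρ0 : 0 ≤ ρ := by rw [hρ]; positivity
  have hρd : 6 * ρ ≤ η * d := by
    have : η * d * (κ * d) ≤ η * d * 2 := mul_le_mul_of_nonneg_left hκd (by positivity)
    nlinarith
  have hρd' : 2 * ρ < d := by nlinarith
  have h2ρ : 2 * ρ ≤ η * d := by linarith
  set e := (y' - y) - (x' - x) with he
  set f := (z' - z) - (x' - x) with hf
  have hen : ‖e‖ ≤ 2 * ρ := (norm_sub_le _ _).trans (by linarith)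
  have hfn : ‖f‖ ≤ 2 * ρ := (norm_sub_le _ _).trans (by linarith)
  have hgn : ‖(z' - z) - (y' - y)‖ ≤ 2 * ρ := (norm_sub_le _ _).trans (by linarith)
  have eu : y' - x' = u + e := by rw [hu, he]; abel
  have ev : z' - x' = v + f := by rw [hv, hf]; abel
  have eg : z' - y' = (z - y) + ((z' - z) - (y' - y)) := by abel
  have hpos : ∀ {a b : E3}, d ≤ ‖a‖ → ‖b‖ ≤ 2 * ρ → 0 < ‖a + b‖ := by
    intro a b h1 h2
    have := norm_sub_le (a + b) b
    rw [add_sub_cancel_right] at this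
    linarith
  have hcr : ‖cr u v‖ * (1 - η) ≤ ‖cr (u + e) (v + f)‖ := by
    have h1 : cr u v = cr (u + e) (v + f) - (cr e v + cr u f + cr e f) := by
      simp only [cr_add_left, cr_add_right]; abel
    have h2 : ‖cr u v‖ ≤ ‖cr (u + e) (v + f)‖ + ‖cr e v + cr u f + cr e f‖ := by
      conv_lhs => rw [h1]
      exact norm_sub_le _ _
    -- The linear terms account for 2ρ(‖u‖ + ‖v‖); the quadratic term 4ρ² is absorbed by one more
    -- ρ(‖u‖ + ‖v‖) because 2ρ < d.
    have h3 : ‖cr e v + cr u f + cr e f‖ ≤ 3 * ρ * (‖u‖ + ‖v‖) := by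
      have g1 : ‖cr e v‖ ≤ 2 * ρ * ‖v‖ :=
        (norm_cr_le _ _).trans (mul_le_mul_of_nonneg_right hen (norm_nonneg _))
      have g2 : ‖cr u f‖ ≤ ‖u‖ * (2 * ρ) :=
        (norm_cr_le _ _).trans (mul_le_mul_of_nonneg_left hfn (norm_nonneg _))
      have g3 : ‖cr e f‖ ≤ 2 * ρ * (2 * ρ) :=
        (norm_cr_le _ _).trans (mul_le_mul hen hfn (norm_nonneg _) (by positivity))
      have g4 := norm_add₃_le (a := cr e v) (b := cr u f) (c := cr e f)
      nlinarith
    -- Curvature bounds area from below. With the factor 12 in ρ, the error above becomes at most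
    -- η‖u × v‖; a thin triangle tolerates only a displacement proportional to its curvature, hence
    -- the form of ρ.
    have h4 : κ * ((‖u‖ + ‖v‖) * d ^ 2) ≤ 4 * ‖cr u v‖ := by
      have : (‖u‖ + ‖v‖) * d ^ 2 ≤ 2 * (‖u‖ * ‖v‖ * ‖z - y‖) := by
        have h5 : ‖u‖ * d * d ≤ ‖u‖ * ‖v‖ * ‖z - y‖ := by gcongr
        have h6 : d * ‖v‖ * d ≤ ‖u‖ * ‖v‖ * ‖z - y‖ := by gcongr
        nlinarith
      have := mul_le_mul_of_nonneg_left this hk0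
      linarith
    have h5 : 3 * ρ * (‖u‖ + ‖v‖) = η / 4 * (κ * ((‖u‖ + ‖v‖) * d ^ 2)) := by rw [hρ]; ring
    have h6 := mul_le_mul_of_nonneg_left h4 (show 0 ≤ η / 4 by positivity)
    linarith
  have s1 := norm_add_le_mul_of_le hη.le hxy hen h2ρ
  have s2 := norm_add_le_mul_of_le hη.le hxz hfn h2ρ
  have s3 := norm_add_le_mul_of_le hη.le hyz hgn h2ρ
  have p1 := hpos hxy hen
  have p2 := hpos hxz hfn
  have p3 := hpos hyz hgn
  rw [← eg] at s3 p3
  have hprod : ‖u + e‖ * ‖v + f‖ * ‖z' - y'‖ ≤ (1 + η) ^ 3 * (‖u‖ * ‖v‖ * ‖z - y‖) := by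
    calc _ ≤ ((1 + η) * ‖u‖) * ((1 + η) * ‖v‖) * ((1 + η) * ‖z - y‖) := by gcongr
      _ = _ := by ring
  rw [kap, eu, ev, ← mul_div_assoc, div_le_div_iff₀ (by positivity) (by positivity)]
  calc κ * (1 - η) * (‖u + e‖ * ‖v + f‖ * ‖z' - y'‖)
      ≤ κ * (1 - η) * ((1 + η) ^ 3 * (‖u‖ * ‖v‖ * ‖z - y‖)) :=
        mul_le_mul_of_nonneg_left hprod (mul_nonneg hk0 (by linarith))
    _ = 2 * (‖cr u v‖ * (1 - η)) * (1 + η) ^ 3 := by linear_combination (1 - η) * (1 + η) ^ 3 * hks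
    _ ≤ _ := by gcongr

theorem mul_le_lintegral_of_subset {α : Type*} [MeasurableSpace α] {μ : Measure α} {s t : Set α}
    (ht : MeasurableSet t) (hts : t ⊆ s) {f : α → ℝ≥0∞} {c r : ℝ≥0∞} (hr : r ≤ μ t)
    (hf : ∀ x ∈ t, c ≤ f x) : c * r ≤ ∫⁻ x in s, f x ∂μ :=
  calc c * r ≤ c * μ t := by gcongr
    _ = ∫⁻ _ in t, c ∂μ := (setLIntegral_const _ _).symm
    _ ≤ ∫⁻ x in t, f x ∂μ := setLIntegral_mono' ht hf
    _ ≤ _ := lintegral_mono_set hts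

theorem le_mengerEnergy {p : ℝ} {γ : ℝ → E3} {A B C : Set E3} (hA : MeasurableSet A)
    (hB : MeasurableSet B) (hC : MeasurableSet C) (hA' : A ⊆ trace γ) (hB' : B ⊆ trace γ)
    (hC' : C ⊆ trace γ) {c r : ℝ≥0∞} (hrA : r ≤ Measure.hausdorffMeasure 1 A)
    (hrB : r ≤ Measure.hausdorffMeasure 1 B) (hrC : r ≤ Measure.hausdorffMeasure 1 C)
    (h : ∀ x ∈ A, ∀ y ∈ B, ∀ z ∈ C, c ≤ (circumR x y z ^ p)⁻¹) :
    c * r * r * r ≤ mengerEnergy p γ :=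
  mul_le_lintegral_of_subset hA hA' hrA fun x hx =>
    mul_le_lintegral_of_subset hB hB' hrB fun y hy =>
      mul_le_lintegral_of_subset hC hC' hrC fun z hz => h x hx y hy z hz

/-! ### Arclength-parametrized loops of length one -/

-- The hypothesis makes φ constant on the fibres of ψ over A, so φ factors through ψ by a
-- K-Lipschitz map on ψ(A). This allows comparing two images when neither map is known to be
-- injective.
open Measure in
theorem hausdorffMeasure_image_le_of_dist_le {X Y Z : Type*} [MetricSpace Y] [MeasurableSpace Y]
    [BorelSpace Y] [MetricSpace Z] [MeasurableSpace Z] [BorelSpace Z] {φ : X → Y} {ψ : X → Z}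
    {A : Set X} {K : NNReal} (h : ∀ x ∈ A, ∀ y ∈ A, dist (φ x) (φ y) ≤ K * dist (ψ x) (ψ y)) :
    hausdorffMeasure 1 (φ '' A) ≤ K * hausdorffMeasure 1 (ψ '' A) := by
  rcases A.eq_empty_or_nonempty with rfl | ⟨a, _⟩
  · simp
  have : Nonempty X := ⟨a⟩
  set r := Function.invFunOn ψ A
  have hr : ∀ z ∈ ψ '' A, r z ∈ A ∧ ψ (r z) = z := fun z hz => Function.invFunOn_pos hz
  have hL : LipschitzOnWith K (φ ∘ r) (ψ '' A) := LipschitzOnWith.of_dist_le_mul fun x hx y hy => by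
    have := h _ (hr x hx).1 _ (hr y hy).1
    rwa [(hr x hx).2, (hr y hy).2] at this
  have hsub : φ '' A ⊆ (φ ∘ r) '' (ψ '' A) := by
    rintro _ ⟨x, hx, rfl⟩
    refine ⟨ψ x, ⟨x, hx, rfl⟩, ?_⟩
    have hx' := hr (ψ x) ⟨x, hx, rfl⟩
    have := h _ hx'.1 x hx
    rw [hx'.2, dist_self, mul_zero] at this
    exact dist_le_zero.1 this
  refine (measure_mono hsub).trans ?_
  simpa using hL.hausdorffMeasure_image_le zero_le_one

/-- A `1`-periodic, `1`-Lipschitz curve whose image has length one. -/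
structure IsLoop (g : ℝ → E3) : Prop where
  lip : ∀ s t, ‖g s - g t‖ ≤ |s - t|
  per : Function.Periodic g 1
  haus : Measure.hausdorffMeasure 1 (range g) = 1

namespace IsLoop

variable {g : ℝ → E3}

theorem continuous (hg : IsLoop g) : Continuous g := by
  have : LipschitzWith 1 g := LipschitzWith.of_dist_le_mul fun s t => by
    simpa [dist_eq_norm] using hg.lip s t
  exact this.continuous

theorem hausdorff_image_le (hg : IsLoop g) (A : Set ℝ) :
    Measure.hausdorffMeasure 1 (g '' A) ≤ volume A := by
  have := hausdorffMeasure_image_le_of_dist_le (φ := g) (ψ := id) (A := A) (K := 1)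
    fun x _ y _ => by simpa [dist_eq_norm] using hg.lip x y
  simpa [hausdorffMeasure_real] using this

theorem image_Ico (hg : IsLoop g) (a : ℝ) : g '' Ico a (a + 1) = range g := by
  refine subset_antisymm (image_subset_range _ _) ?_
  rintro _ ⟨t, rfl⟩
  obtain ⟨y, hy, h⟩ := hg.per.exists_mem_Ico zero_lt_one t a
  exact ⟨y, hy, h.symm⟩

/-- One period has length 1 and so does the image. The complement of A contributes at most its own
volume, so A must contribute at least its own. -/
theorem volume_le_hausdorff_image (hg : IsLoop g) {A : Set ℝ} (hA : MeasurableSet A) {a : ℝ}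
    (h : A ⊆ Ico a (a + 1)) : volume A ≤ Measure.hausdorffMeasure 1 (g '' A) := by
  have h1 : (1 : ℝ≥0∞) ≤ Measure.hausdorffMeasure 1 (g '' A) +
      volume (Ico a (a + 1) \ A) := by
    rw [← hg.haus, ← hg.image_Ico a]
    conv_lhs => rw [← union_sdiff_cancel h, image_union]
    exact (measure_union_le _ _).trans (add_le_add le_rfl (hg.hausdorff_image_le _))
  have h2 : volume A + volume (Ico a (a + 1) \ A) = 1 := by
    rw [measure_add_sdiff hA.nullMeasurableSet, union_eq_self_of_subset_left h]
    simp
  have h3 : volume (Ico a (a + 1) \ A) ≠ ∞ :=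
    ne_top_of_le_ne_top (by rw [h2]; simp) (self_le_add_left _ (volume A))
  rw [← h2] at h1
  exact (ENNReal.add_le_add_iff_right h3).1 h1

/-- Retracing costs length: if A only covers what B covers, the image of A ∪ B has length at most
|B|, while no length may be lost. This is the source of all injectivity statements below. -/
theorem volume_eq_zero_of_image_subset (hg : IsLoop g) {A B : Set ℝ} (hA : MeasurableSet A)
    (hB : MeasurableSet B) {a : ℝ} (hAa : A ⊆ Ico a (a + 1)) (hBa : B ⊆ Ico a (a + 1))
    (hd : Disjoint A B) (h : g '' A ⊆ g '' B) : volume A = 0 := by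
  have h1 := hg.volume_le_hausdorff_image (hA.union hB) (union_subset hAa hBa)
  rw [image_union, union_eq_self_of_subset_left h, measure_union hd hB] at h1
  have h2 := h1.trans (hg.hausdorff_image_le B)
  have h3 : volume B ≠ ∞ := ne_top_of_le_ne_top (by simp) (measure_mono hBa)
  have h4 : volume A + volume B ≤ 0 + volume B := by rwa [zero_add]
  exact le_antisymm ((ENNReal.add_le_add_iff_right h3).1 h4) zero_le

theorem isCompact_range (hg : IsLoop g) : IsCompact (range g) := by
  have h : range g = g '' Icc 0 1 := by
    refine subset_antisymm ?_ (image_subset_range _ _)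
    rw [← hg.image_Ico 0, zero_add]
    exact image_mono Ico_subset_Icc_self
  rw [h]
  exact isCompact_Icc.image hg.continuous

/-- The arc run through during time ρ after x stays in the ball and loses no length. -/
theorem le_hausdorff_inter_closedBall (hg : IsLoop g) {x : E3} (hx : x ∈ range g) {ρ : ℝ}
    (hρ1 : ρ ≤ 1) :
    ENNReal.ofReal ρ ≤ Measure.hausdorffMeasure 1 (range g ∩ Metric.closedBall x ρ) := by
  obtain ⟨t, rfl⟩ := hx
  have h := hg.volume_le_hausdorff_image (A := Ico t (t + ρ)) measurableSet_Ico (a := t)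
    (Ico_subset_Ico_right (by linarith))
  rw [Real.volume_Ico, add_sub_cancel_left] at h
  refine h.trans (measure_mono ?_)
  rintro _ ⟨s, ⟨hs1, hs2⟩, rfl⟩
  refine ⟨⟨s, rfl⟩, ?_⟩
  rw [Metric.mem_closedBall, dist_eq_norm]
  exact (hg.lip _ _).trans (by rw [abs_of_nonneg] <;> linarith)

end IsLoop

/-- Project the curve onto its own chord: the projection is a real absolutely continuous function
with derivative at most the chord length almost everywhere, and integrating it gives the square of
that length. -/
theorem IsUnitLoop.norm_sub_le {γ : ℝ → E3} (hγ : IsUnitLoop γ) {s t : ℝ} (hs : s ∈ Icc (0 : ℝ) 1)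
    (ht : t ∈ Icc (0 : ℝ) 1) (hst : s ≤ t) : ‖γ t - γ s‖ ≤ t - s := by
  obtain ⟨K, hK⟩ := hγ.lipschitz
  set v := γ t - γ s with hv
  let φ : ℝ → ℝ := fun r => inner ℝ v (γ r)
  have hsub : uIcc s t ⊆ Icc 0 1 := by
    rw [uIcc_of_le hst]; exact Icc_subset_Icc hs.1 ht.2
  have hac : AbsolutelyContinuousOnInterval φ s t :=
    (((innerSL ℝ v).lipschitz.comp_lipschitzOnWith
      (hK.mono hsub))).absolutelyContinuousOnInterval
  have hint := hac.integral_deriv_eq_sub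
  have hb : ‖∫ r in s..t, deriv φ r‖ ≤ ‖v‖ * |t - s| := by
    apply intervalIntegral.norm_integral_le_of_norm_le_const_ae
    have h1 := (ae_restrict_iff' measurableSet_Ioo).1 hγ.unit_speed
    have h2 : ∀ᵐ r : ℝ, r ≠ t := by simp [ae_iff]
    filter_upwards [h1, h2] with r hr hrt hmem
    rw [uIoc_of_le hst] at hmem
    have h3 := hr ⟨hs.1.trans_lt hmem.1, (lt_of_le_of_ne hmem.2 hrt).trans_le ht.2⟩
    -- At a point of non-differentiability `deriv` is 0 by convention, which is incompatible with
    -- speed one.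
    have hd : DifferentiableAt ℝ γ r := by
      by_contra h
      rw [deriv_zero_of_not_differentiableAt h, norm_zero] at h3
      norm_num at h3
    have h4 : HasDerivAt φ (inner ℝ v (deriv γ r)) r :=
      (innerSL ℝ v).hasFDerivAt.comp_hasDerivAt r hd.hasDerivAt
    rw [h4.deriv]
    exact (norm_inner_le_norm _ _).trans (by rw [h3, mul_one])
  have hφ : φ t - φ s = ‖v‖ ^ 2 := by
    simp only [φ]
    rw [← inner_sub_right, real_inner_self_eq_norm_sq]
  rw [hint, hφ, Real.norm_of_nonneg (by positivity), abs_of_nonneg (by linarith)] at hb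
  rcases (norm_nonneg v).eq_or_lt with h | h
  · rw [← h]; linarith
  · nlinarith

/-- The periodic extension of a curve on `[0, 1]`. -/
noncomputable def perExt (γ : ℝ → E3) : ℝ → E3 := fun t => γ (Int.fract t)

theorem perExt_eq {γ : ℝ → E3} (h : γ 0 = γ 1) {t : ℝ} (n : ℤ) (ht : t ∈ Icc (n : ℝ) (n + 1)) :
    perExt γ t = γ (t - n) := by
  rcases ht.2.eq_or_lt with h1 | h1
  · have : Int.fract t = 0 := by
      rw [h1]; exact_mod_cast Int.fract_intCast (n + 1)
    rw [perExt, this, h, h1]; congr 1; ring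
  · have : ⌊t⌋ = n := Int.floor_eq_iff.2 ⟨ht.1, h1⟩
    rw [perExt, Int.fract, this]

theorem range_perExt {γ : ℝ → E3} (h : γ 0 = γ 1) : range (perExt γ) = trace γ := by
  ext x
  constructor
  · rintro ⟨t, rfl⟩
    exact ⟨_, ⟨Int.fract_nonneg t, (Int.fract_lt_one t).le⟩, rfl⟩
  · rintro ⟨t, ht, rfl⟩
    exact ⟨t, by simpa using perExt_eq h 0 (by simpa using ht)⟩

theorem IsUnitLoop.isLoop_perExt {γ : ℝ → E3} (hγ : IsUnitLoop γ) : IsLoop (perExt γ) := by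
  have hpiece : ∀ (n : ℤ) {s t : ℝ}, (n : ℝ) ≤ s → s ≤ t → t ≤ n + 1 →
      ‖perExt γ t - perExt γ s‖ ≤ t - s := by
    intro n s t hs hst ht
    rw [perExt_eq hγ.closed n ⟨hs, hst.trans ht⟩, perExt_eq hγ.closed n ⟨hs.trans hst, ht⟩]
    have := hγ.norm_sub_le (s := s - n) (t := t - n) ⟨by linarith, by linarith⟩
      ⟨by linarith, by linarith⟩ (by linarith)
    linarith
  have hint : ∀ n : ℤ, perExt γ n = γ 0 := by intro n; simp [perExt]
  have hle : ∀ {s t : ℝ}, s ≤ t → ‖perExt γ t - perExt γ s‖ ≤ t - s := by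
    intro s t hst
    rcases (Int.floor_mono hst).eq_or_lt with h | h
    · exact hpiece ⌊s⌋ (Int.floor_le s) hst (by rw [h]; exact (Int.lt_floor_add_one t).le)
    · have h1 := hpiece ⌊s⌋ (Int.floor_le s) (Int.lt_floor_add_one s).le le_rfl
      have h2 := hpiece ⌊t⌋ le_rfl (Int.floor_le t) (Int.lt_floor_add_one t).le
      have h3 : ((⌊s⌋ : ℝ)) + 1 ≤ ⌊t⌋ := by exact_mod_cast h
      have h4 : perExt γ ((⌊s⌋ : ℝ) + 1) = perExt γ ⌊t⌋ := by
        rw [hint]; exact_mod_cast hint (⌊s⌋ + 1)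
      rw [h4] at h1
      have h5 := norm_add_le (perExt γ t - perExt γ ⌊t⌋) (perExt γ ⌊t⌋ - perExt γ s)
      rw [sub_add_sub_cancel] at h5
      linarith
  refine ⟨fun s t => ?_, fun t => by simp [perExt], ?_⟩
  · rcases le_total s t with h | h
    · rw [norm_sub_rev, abs_sub_comm, abs_of_nonneg (by linarith)]; exact hle h
    · rw [abs_of_nonneg (by linarith)]; exact hle h
  · rw [range_perExt hγ.closed]; exact hγ.hausdorff_eq_one

/-! ### The round circle of length one -/

theorem norm_sq_circle_sub {a b : E3} {r : ℝ} (ha : ‖a‖ = r) (hb : ‖b‖ = r) (hab : inner ℝ a b = 0)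
    (s t : ℝ) : ‖(Real.cos s • a + Real.sin s • b) - (Real.cos t • a + Real.sin t • b)‖ ^ 2 =
      (2 * r * Real.sin ((s - t) / 2)) ^ 2 := by
  have h : (Real.cos s • a + Real.sin s • b) - (Real.cos t • a + Real.sin t • b) =
      (Real.cos s - Real.cos t) • a + (Real.sin s - Real.sin t) • b := by module
  rw [h, norm_add_sq_real, norm_smul, norm_smul, inner_smul_left, inner_smul_right, hab, ha, hb,
    Real.norm_eq_abs, Real.norm_eq_abs, mul_pow, mul_pow, sq_abs, sq_abs, Real.cos_sub_cos,
    Real.sin_sub_sin]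
  linear_combination 4 * r ^ 2 * Real.sin ((s - t) / 2) ^ 2 * Real.sin_sq_add_cos_sq ((s + t) / 2)

theorem norm_circle_sub {a b : E3} {r : ℝ} (ha : ‖a‖ = r) (hb : ‖b‖ = r) (hab : inner ℝ a b = 0)
    (s t : ℝ) : ‖(Real.cos s • a + Real.sin s • b) - (Real.cos t • a + Real.sin t • b)‖ =
      2 * r * |Real.sin ((s - t) / 2)| := by
  have hr : 0 ≤ r := ha ▸ norm_nonneg a
  have := norm_sq_circle_sub ha hb hab s t
  rw [← sq_abs (2 * r * _), abs_mul, abs_of_nonneg (by positivity : 0 ≤ 2 * r)] at this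
  exact (pow_left_inj₀ (norm_nonneg _) (by positivity) two_ne_zero).1 this

/-- For the lower bound, cut the period into n short pieces on which the inverse is (1 +
ε)-Lipschitz. Each image has length at least 1/(n(1 + ε)), injectivity makes the images disjoint,
and ε tends to 0. -/
theorem hausdorff_range_eq_one {g : ℝ → E3} (hl : ∀ s t, ‖g s - g t‖ ≤ |s - t|)
    (hp : Function.Periodic g 1) (hi : InjOn g (Ico 0 1))
    (hloc : ∀ ε > 0, ∃ δ > 0, ∀ s t, |s - t| ≤ δ → |s - t| ≤ (1 + ε) * ‖g s - g t‖) :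
    Measure.hausdorffMeasure 1 (range g) = 1 := by
  have hrange : range g = g '' Ico 0 1 := by
    refine subset_antisymm ?_ (image_subset_range _ _)
    rintro _ ⟨t, rfl⟩
    obtain ⟨y, hy, h⟩ := hp.exists_mem_Ico zero_lt_one t 0
    exact ⟨y, by simpa using hy, h.symm⟩
  have hcont : Continuous g := by
    have : LipschitzWith 1 g := LipschitzWith.of_dist_le_mul fun s t => by
      simpa [dist_eq_norm] using hl s t
    exact this.continuous
  rw [hrange]
  apply le_antisymm
  · have := hausdorffMeasure_image_le_of_dist_le (φ := g) (ψ := id) (A := Ico 0 1) (K := 1)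
      fun x _ y _ => by simpa [dist_eq_norm] using hl x y
    simpa [hausdorffMeasure_real] using this
  · have key : ∀ ε : NNReal, 0 < ε →
        (1 : ℝ≥0∞) ≤ (1 + ε : NNReal) * Measure.hausdorffMeasure 1 (g '' Ico 0 1) := by
      intro ε hε
      obtain ⟨δ, hδ, h⟩ := hloc ε hε
      obtain ⟨N, hN⟩ := exists_nat_one_div_lt hδ
      set n : ℕ := N + 1 with hn
      have hn0 : (0 : ℝ) < n := by positivity
      have hN : 1 / (n : ℝ) < δ := by rw [hn]; exact_mod_cast hN
      let A : ℕ → Set ℝ := fun j => Ico ((j : ℝ) / n) ((j + 1) / n)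
      have hA : ∀ j, ENNReal.ofReal (1 / n) ≤
          (1 + ε : NNReal) * Measure.hausdorffMeasure 1 (g '' A j) := by
        intro j
        have := hausdorffMeasure_image_le_of_dist_le (φ := id) (ψ := g) (A := A j) (K := 1 + ε)
          fun x hx y hy => by
            rw [dist_eq_norm, dist_eq_norm]
            have : |x - y| ≤ δ := by
              have h1 : ((j : ℝ) + 1) / n = j / n + 1 / n := by ring
              have hx1 := hx.1
              have hx2 := hx.2
              have hy1 := hy.1
              have hy2 := hy.2
              rw [abs_le]
              constructor <;> linarith
            simpa using h x y this
        rw [image_id, hausdorffMeasure_real, Real.volume_Ico] at this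
        convert! this using 2
        ring
      have hsub : ∀ j ∈ Finset.range n, A j ⊆ Ico 0 1 := by
        intro j hj
        apply Ico_subset_Ico (by positivity)
        rw [div_le_one hn0]
        exact_mod_cast Finset.mem_range.1 hj
      have hdisj : ∀ i j : ℕ, i < j → Disjoint (A i) (A j) := by
        intro i j hij
        rw [Set.disjoint_left]
        intro x hx hx'
        have : ((i : ℝ) + 1) / n ≤ j / n := by gcongr; exact_mod_cast hij
        exact absurd (hx.2.trans_le this) (not_lt.2 hx'.1)
      have hpw : Set.PairwiseDisjoint (Finset.range n : Set ℕ) fun j => g '' A j := by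
        intro i hI j hJ hij
        have : Disjoint (A i) (A j) := by
          rcases lt_or_gt_of_ne hij with h | h
          · exact hdisj i j h
          · exact (hdisj j i h).symm
        change Disjoint (g '' A i) (g '' A j)
        rw [disjoint_iff_inter_eq_empty, ← hi.image_inter (hsub i hI) (hsub j hJ), this.inter_eq,
          image_empty]
      have hmeas : ∀ j ∈ Finset.range n, MeasurableSet (g '' A j) := fun j hj =>
        measurableSet_Ico.image_of_continuousOn_injOn hcont.continuousOn (hi.mono (hsub j hj))
      have hsum := measure_biUnion_finset (μ := Measure.hausdorffMeasure 1) hpw hmeas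
      have hle : (⋃ j ∈ Finset.range n, g '' A j) ⊆ g '' Ico 0 1 :=
        iUnion₂_subset fun j hj => image_mono (hsub j hj)
      calc (1 : ℝ≥0∞) = ∑ j ∈ Finset.range n, ENNReal.ofReal (1 / n) := by
            rw [Finset.sum_const, Finset.card_range, nsmul_eq_mul, ← ENNReal.ofReal_natCast,
              ← ENNReal.ofReal_mul hn0.le, mul_one_div_cancel hn0.ne', ENNReal.ofReal_one]
        _ ≤ ∑ j ∈ Finset.range n, (1 + ε : NNReal) * Measure.hausdorffMeasure 1 (g '' A j) :=
            Finset.sum_le_sum fun j _ => hA j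
        _ = (1 + ε : NNReal) * Measure.hausdorffMeasure 1 (⋃ j ∈ Finset.range n, g '' A j) := by
            rw [← Finset.mul_sum, hsum]
        _ ≤ _ := by gcongr
    set m := Measure.hausdorffMeasure 1 (g '' Ico 0 1) with hm
    by_cases htop : m = ∞
    · rw [htop]; exact le_top
    have ht : Filter.Tendsto (fun ε : NNReal => ((1 + ε : NNReal) : ℝ≥0∞) * m)
        (nhdsWithin 0 (Ioi 0)) (nhds ((1 + 0 : NNReal) * m)) := by
      apply Filter.Tendsto.mono_left _ nhdsWithin_le_nhds
      apply ENNReal.Tendsto.mul_const _ (Or.inr htop)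
      exact ENNReal.tendsto_coe.2 ((continuous_const.add continuous_id).tendsto 0)
    have := ge_of_tendsto ht (Filter.eventually_of_mem self_mem_nhdsWithin fun ε hε => key ε hε)
    simpa using this

theorem planar_circle_identity {p q a b c d : ℝ} (h1 : 2 * (p * a + q * b) = a ^ 2 + b ^ 2)
    (h2 : 2 * (p * c + q * d) = c ^ 2 + d ^ 2) :
    4 * (p ^ 2 + q ^ 2) * (a * d - b * c) ^ 2 =
      (a ^ 2 + b ^ 2) * (c ^ 2 + d ^ 2) * ((c - a) ^ 2 + (d - b) ^ 2) := by
  linear_combination ((c ^ 2 + d ^ 2) * (2 * (p * a + q * b) + (a ^ 2 + b ^ 2)) -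
    2 * (a * c + b * d) * (2 * (p * c + q * d))) * h1 +
    ((a ^ 2 + b ^ 2) * (2 * (p * c + q * d) + (c ^ 2 + d ^ 2)) -
    2 * (a * c + b * d) * (a ^ 2 + b ^ 2)) * h2

theorem mul_kap_le_one_of_planar {x y z o : E3} {r : ℝ} (hr : 0 ≤ r) (hx2 : x 2 = 0) (hy2 : y 2 = 0)
    (hz2 : z 2 = 0) (ho2 : o 2 = 0) (hx : ‖x - o‖ = r) (hy : ‖y - o‖ = r) (hz : ‖z - o‖ = r) :
    r * kap x y z ≤ 1 := by
  have hx' : ‖x - o‖ ^ 2 = r ^ 2 := by rw [hx]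
  have hy' : ‖y - o‖ ^ 2 = r ^ 2 := by rw [hy]
  have hz' : ‖z - o‖ ^ 2 = r ^ 2 := by rw [hz]
  have key : (r * (2 * ‖cr (y - x) (z - x)‖)) ^ 2 = (‖y - x‖ * ‖z - x‖ * ‖z - y‖) ^ 2 := by
    rw [mul_pow, mul_pow, mul_pow, mul_pow, ← hx']
    simp only [E3.norm_sq, cr_apply_zero, cr_apply_one, cr_apply_two, PiLp.sub_apply, hx2, hy2, hz2,
      ho2] at hx' hy' hz' ⊢
    have := planar_circle_identity (p := o 0 - x 0) (q := o 1 - x 1) (a := y 0 - x 0)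
      (b := y 1 - x 1) (c := z 0 - x 0) (d := z 1 - x 1) (by linarith) (by linarith)
    linear_combination this
  have h2 := (pow_left_inj₀ (by positivity) (by positivity) two_ne_zero).1 key
  rw [kap, ← mul_div_assoc, h2]
  exact div_self_le_one _

/-- The round circle of length one. -/
noncomputable def unitCircleLoop (t : ℝ) : E3 :=
  (Real.cos (2 * Real.pi * t) • EuclideanSpace.single 0 (2 * Real.pi)⁻¹ +
    Real.sin (2 * Real.pi * t) • EuclideanSpace.single 1 (2 * Real.pi)⁻¹) -
    EuclideanSpace.single 0 (2 * Real.pi)⁻¹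

theorem norm_unitCircleLoop_sub (s t : ℝ) :
    ‖unitCircleLoop s - unitCircleLoop t‖ = |Real.sin (Real.pi * (s - t))| / Real.pi := by
  have hπ := Real.pi_pos
  have hn : ∀ i : Fin 3, ‖(EuclideanSpace.single i (2 * Real.pi)⁻¹ : E3)‖ = (2 * Real.pi)⁻¹ := by
    intro i
    rw [PiLp.norm_single, Real.norm_of_nonneg (by positivity)]
  have h0 : inner ℝ (EuclideanSpace.single 0 (2 * Real.pi)⁻¹ : E3)
      (EuclideanSpace.single 1 (2 * Real.pi)⁻¹) = 0 := by
    rw [EuclideanSpace.inner_single_left]; simp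
  rw [unitCircleLoop, unitCircleLoop, sub_sub_sub_cancel_right, norm_circle_sub (hn 0) (hn 1) h0]
  have : (2 * Real.pi * s - 2 * Real.pi * t) / 2 = Real.pi * (s - t) := by ring
  rw [this]
  field_simp

/-- With y = π|x| ≤ 1 one has sin y ≥ y(1 - y), and the second threshold y ≤ ε/(1 + ε) says exactly
that (1 + ε)(1 - y) ≥ 1. -/
theorem abs_le_mul_abs_sin_div {x ε : ℝ} (hε : 0 < ε)
    (hx : |x| ≤ min (1 / Real.pi) (ε / (1 + ε) * (1 / Real.pi))) :
    |x| ≤ (1 + ε) * (|Real.sin (Real.pi * x)| / Real.pi) := by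
  have hπ := Real.pi_pos
  set y := Real.pi * |x| with hy
  have hy0 : 0 ≤ y := by positivity
  have hy1 : y ≤ 1 := by
    have := mul_le_mul_of_nonneg_left (hx.trans (min_le_left _ _)) hπ.le
    rwa [mul_one_div_cancel hπ.ne'] at this
  have hy2 : y ≤ ε / (1 + ε) := by
    have := mul_le_mul_of_nonneg_left (hx.trans (min_le_right _ _)) hπ.le
    field_simp at this ⊢
    linarith
  have hs : |Real.sin (Real.pi * x)| = Real.sin y := by
    rw [hy, ← abs_of_pos hπ, ← abs_mul, abs_of_pos hπ]
    rcases le_total 0 (Real.pi * x) with h | h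
    · rw [abs_of_nonneg h, abs_of_nonneg]
      apply Real.sin_nonneg_of_nonneg_of_le_pi h
      have : Real.pi * x ≤ y := mul_le_mul_of_nonneg_left (le_abs_self _) hπ.le
      linarith [Real.pi_gt_three]
    · rw [abs_of_nonpos h, Real.sin_neg, abs_of_nonpos]
      apply Real.sin_nonpos_of_nonpos_of_neg_pi_le h
      have : Real.pi * (-x) ≤ y := mul_le_mul_of_nonneg_left (neg_le_abs _) hπ.le
      linarith [Real.pi_gt_three]
  have hlow : y * (1 - y) ≤ Real.sin y := by
    rcases hy0.eq_or_lt with h | h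
    · rw [← h]; simp
    · have := Real.sin_gt_sub_cube h
      have h2 : y ^ 2 * y ≤ y ^ 2 * 1 := mul_le_mul_of_nonneg_left hy1 (sq_nonneg y)
      nlinarith [sq_nonneg y]
  have h3 : y * (1 + ε) ≤ ε := by rwa [le_div_iff₀ (by positivity)] at hy2
  have h4 : y ≤ (1 + ε) * Real.sin y := by nlinarith
  rw [hs, ← mul_div_assoc, le_div_iff₀ hπ]
  linarith

theorem abs_sin_pi_mul_div_le (x : ℝ) : |Real.sin (Real.pi * x)| / Real.pi ≤ |x| := by
  rw [div_le_iff₀ Real.pi_pos]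
  refine Real.abs_sin_le_abs.trans ?_
  rw [abs_mul, abs_of_pos Real.pi_pos, mul_comm]

theorem unitCircleLoop_periodic : Function.Periodic unitCircleLoop 1 := by
  intro t
  have : 2 * Real.pi * (t + 1) = 2 * Real.pi * t + 2 * Real.pi := by ring
  simp only [unitCircleLoop, this, Real.cos_add_two_pi, Real.sin_add_two_pi]

theorem unitCircleLoop_lip (s t : ℝ) : ‖unitCircleLoop s - unitCircleLoop t‖ ≤ |s - t| := by
  rw [norm_unitCircleLoop_sub]; exact abs_sin_pi_mul_div_le _

theorem range_unitCircleLoop : range unitCircleLoop = trace unitCircleLoop := by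
  refine subset_antisymm ?_ (image_subset_range _ _)
  rintro _ ⟨t, rfl⟩
  obtain ⟨y, hy, h⟩ := unitCircleLoop_periodic.exists_mem_Ico zero_lt_one t 0
  exact ⟨y, Ico_subset_Icc_self (by simpa using hy), h.symm⟩

theorem isUnitLoop_unitCircleLoop : IsUnitLoop unitCircleLoop where
  lipschitz := ⟨1, LipschitzOnWith.of_dist_le_mul fun s _ t _ => by
    simpa [dist_eq_norm] using unitCircleLoop_lip s t⟩
  unit_speed := by
    refine Filter.Eventually.of_forall fun t => ?_
    have hc : HasDerivAt (fun t : ℝ => 2 * Real.pi * t) (2 * Real.pi) t := by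
      simpa using (hasDerivAt_id t).const_mul (2 * Real.pi)
    have h := ((hc.cos.smul_const (EuclideanSpace.single 0 (2 * Real.pi)⁻¹ : E3)).add
      (hc.sin.smul_const (EuclideanSpace.single 1 (2 * Real.pi)⁻¹ : E3))).sub_const
      (EuclideanSpace.single 0 (2 * Real.pi)⁻¹ : E3)
    have h' : deriv unitCircleLoop t = _ := h.deriv
    rw [h', ← pow_eq_one_iff_of_nonneg (norm_nonneg _) two_ne_zero, E3.norm_sq]
    have hπ := Real.pi_ne_zero
    simp
    field_simp
    exact Real.sin_sq_add_cos_sq _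
  closed := by simpa using (unitCircleLoop_periodic 0).symm
  origin_mem := ⟨0, by simp, by simp [unitCircleLoop]⟩
  hausdorff_eq_one := by
    have hπ := Real.pi_pos
    rw [← range_unitCircleLoop]
    apply hausdorff_range_eq_one unitCircleLoop_lip unitCircleLoop_periodic
    · have key : ∀ s ∈ Ico (0 : ℝ) 1, ∀ t ∈ Ico (0 : ℝ) 1, t < s →
          unitCircleLoop s ≠ unitCircleLoop t := by
        intro s hs t ht h he
        have h1 := norm_unitCircleLoop_sub s t
        rw [he, sub_self, norm_zero, eq_comm, div_eq_zero_iff, abs_eq_zero] at h1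
        have h2 : 0 < Real.sin (Real.pi * (s - t)) :=
          Real.sin_pos_of_pos_of_lt_pi (mul_pos hπ (by linarith)) (by nlinarith [hs.2, ht.1])
        rcases h1 with h1 | h1 <;> linarith
      intro s hs t ht he
      rcases lt_trichotomy s t with h | h | h
      · exact absurd he.symm (key t ht s hs h)
      · exact h
      · exact absurd he (key s hs t ht h)
    · intro ε hε
      refine ⟨min (1 / Real.pi) (ε / (1 + ε) * (1 / Real.pi)), by positivity, fun s t h => ?_⟩
      rw [norm_unitCircleLoop_sub]
      exact abs_le_mul_abs_sin_div hε h

theorem mengerEnergy_unitCircleLoop_le {p : ℝ} (hp : 0 < p) :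
    mengerEnergy p unitCircleLoop ≤ ENNReal.ofReal ((2 * Real.pi) ^ p) := by
  have hπ := Real.pi_pos
  set T := trace unitCircleLoop with hT
  have hcurv : ∀ x ∈ T, ∀ y ∈ T, ∀ z ∈ T,
      (circumR x y z ^ p)⁻¹ ≤ ENNReal.ofReal ((2 * Real.pi) ^ p) := by
    have hmem : ∀ x ∈ T, x 2 = 0 ∧
        ‖x - -EuclideanSpace.single 0 (2 * Real.pi)⁻¹‖ = (2 * Real.pi)⁻¹ := by
      rintro _ ⟨t, _, rfl⟩
      refine ⟨by simp [unitCircleLoop], ?_⟩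
      rw [← pow_left_inj₀ (norm_nonneg _) (by positivity) two_ne_zero, E3.norm_sq]
      simp [unitCircleLoop]
      field_simp
      exact Real.cos_sq_add_sin_sq _
    intro x hx y hy z hz
    rw [circumR_rpow_inv _ _ _ hp]
    apply ENNReal.ofReal_le_ofReal
    apply Real.rpow_le_rpow (kap_nonneg _ _ _) _ hp.le
    have := mul_kap_le_one_of_planar (r := (2 * Real.pi)⁻¹) (by positivity) (hmem x hx).1
      (hmem y hy).1 (hmem z hz).1 (o := -EuclideanSpace.single 0 (2 * Real.pi)⁻¹) (by simp)
      (hmem x hx).2 (hmem y hy).2 (hmem z hz).2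
    rwa [inv_mul_le_iff₀ (by positivity), mul_one] at this
  have hvol : Measure.hausdorffMeasure 1 T = 1 := isUnitLoop_unitCircleLoop.hausdorff_eq_one
  have hmeas : MeasurableSet T := by
    rw [hT, ← range_unitCircleLoop]
    exact isUnitLoop_unitCircleLoop.isLoop_perExt.isCompact_range.measurableSet |> fun h => by
      rwa [range_perExt isUnitLoop_unitCircleLoop.closed, ← range_unitCircleLoop] at h
  have hint : ∀ {f : E3 → ℝ≥0∞} {c : ℝ≥0∞}, (∀ x ∈ T, f x ≤ c) →
      ∫⁻ x in T, f x ∂(Measure.hausdorffMeasure 1) ≤ c := by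
    intro f c h
    refine (setLIntegral_mono' hmeas h).trans ?_
    rw [setLIntegral_const, hvol, mul_one]
  exact hint fun x hx => hint fun y hy => hint fun z hz => hcurv x hx y hy z hz

/-! ### From the energy to pointwise bounds for the Menger curvature -/

theorem IsLoop.norm_sub_le_one {g : ℝ → E3} (hg : IsLoop g) {x y : E3} (hx : x ∈ range g)
    (hy : y ∈ range g) : ‖x - y‖ ≤ 1 := by
  rw [← hg.image_Ico 0] at hx hy
  obtain ⟨s, hs, rfl⟩ := hx
  obtain ⟨t, ht, rfl⟩ := hy
  refine (hg.lip s t).trans ?_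
  rw [abs_le]
  constructor <;> linarith [hs.1, hs.2, ht.1, ht.2]

/-- Restrict the triple integral to the balls of radius ρ = ηκd²/12 about the three points. Each
contributes length at least ρ, and on their product the curvature drops at most by the factor (1 -
η)/(1 + η)³. -/
theorem kap_rpow_mul_le {γ : ℝ → E3} (hγ : IsUnitLoop γ) {p : ℝ} (hp : 0 < p)
    (hE : mengerEnergy p γ ≤ ENNReal.ofReal ((2 * Real.pi) ^ p)) {x y z : E3} (hx : x ∈ trace γ)
    (hy : y ∈ trace γ) (hz : z ∈ trace γ) {d η : ℝ} (hd : 0 < d) (hη : 0 < η) (hη1 : η < 1)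
    (hxy : d ≤ ‖y - x‖) (hxz : d ≤ ‖z - x‖) (hyz : d ≤ ‖z - y‖) :
    (kap x y z * ((1 - η) / (1 + η) ^ 3)) ^ p * (η * kap x y z * d ^ 2 / 12) ^ 3 ≤
      (2 * Real.pi) ^ p := by
  have hg := hγ.isLoop_perExt
  have hr := range_perExt hγ.closed
  set ρ := η * kap x y z * d ^ 2 / 12 with hρ
  have hk := kap_nonneg x y z
  have hρ0 : 0 ≤ ρ := by positivity
  have hρ1 : ρ ≤ 1 := by
    have h1 := kap_mul_le_two (x := x) hyz
    have h2 : d ≤ 1 := hyz.trans (hg.norm_sub_le_one (hr ▸ hz) (hr ▸ hy))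
    have h3 : ρ = η * (kap x y z * d) * d / 12 := by rw [hρ]; ring
    have h4 : η * (kap x y z * d) * d ≤ 1 * 2 * 1 := by gcongr
    linarith
  have hc : 0 ≤ kap x y z * ((1 - η) / (1 + η) ^ 3) := by
    have : 0 < 1 - η := by linarith
    positivity
  have hball : ∀ w ∈ trace γ, MeasurableSet (trace γ ∩ Metric.closedBall w ρ) ∧
      ENNReal.ofReal ρ ≤ Measure.hausdorffMeasure 1 (trace γ ∩ Metric.closedBall w ρ) := by
    intro w hw
    rw [← hr] at hw ⊢
    exact ⟨hg.isCompact_range.measurableSet.inter Metric.isClosed_closedBall.measurableSet,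
      hg.le_hausdorff_inter_closedBall hw hρ1⟩
  have h := le_mengerEnergy (p := p) (γ := γ) (hball x hx).1 (hball y hy).1 (hball z hz).1
    inter_subset_left inter_subset_left inter_subset_left (hball x hx).2 (hball y hy).2
    (hball z hz).2 (c := ENNReal.ofReal ((kap x y z * ((1 - η) / (1 + η) ^ 3)) ^ p))
    fun x' hx' y' hy' z' hz' => by
      rw [circumR_rpow_inv _ _ _ hp]
      apply ENNReal.ofReal_le_ofReal
      apply Real.rpow_le_rpow hc _ hp.le
      refine kap_perturb hd hη hη1 hxy hxz hyz hρ ?_ ?_ ?_ <;> rw [← dist_eq_norm]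
      exacts [hx'.2, hy'.2, hz'.2]
  have hc' := Real.rpow_nonneg hc p
  rw [← ENNReal.ofReal_mul hc', ← ENNReal.ofReal_mul (by positivity),
    ← ENNReal.ofReal_mul (by positivity)] at h
  have := (ENNReal.ofReal_le_ofReal_iff (by positivity)).1 (h.trans hE)
  linarith

/-- Low-energy loops have Menger curvature growing at most like a small negative power of the
distance of the three points. -/
theorem kap_le_of_energy {γ : ℝ → E3} (hγ : IsUnitLoop γ) {p : ℝ} (hp : 24 ≤ p)
    (hE : mengerEnergy p γ ≤ ENNReal.ofReal ((2 * Real.pi) ^ p)) {x y z : E3} (hx : x ∈ trace γ)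
    (hy : y ∈ trace γ) (hz : z ∈ trace γ) {d : ℝ} (hd : 0 < d)
    (hxy : d ≤ ‖y - x‖) (hxz : d ≤ ‖z - x‖) (hyz : d ≤ ‖z - y‖) :
    kap x y z ≤ 26 * d ^ (-(1 / 4) : ℝ) := by
  have hg := hγ.isLoop_perExt
  have hr := range_perExt hγ.closed
  have hd1 : d ≤ 1 := hyz.trans (hg.norm_sub_le_one (hr ▸ hz) (hr ▸ hy))
  have hπ := Real.pi_pos
  have hπ' := Real.pi_lt_d2
  by_contra! hlt
  have hmain := kap_rpow_mul_le hγ (by linarith) hE hx hy hz hd (η := 1 / 10) (by norm_num)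
    (by norm_num) hxy hxz hyz
  set κ := kap x y z
  set b : ℝ := d ^ (-(1 / 4) : ℝ) with hb
  have hb1 : 1 ≤ b := Real.one_le_rpow_of_pos_of_le_one_of_nonpos hd hd1 (by norm_num)
  -- The three ball lengths cost a factor of order d⁶, and 24 powers of d^(-1/4) pay for it; hence
  -- the threshold p ≥ 24.
  have hb24 : b ^ 24 * d ^ 6 = 1 := by
    rw [hb, ← Real.rpow_natCast, ← Real.rpow_mul hd.le, ← Real.rpow_natCast d,
      ← Real.rpow_add hd]
    norm_num
  -- For η = 1/10 the loss factor exceeds 1/2, and 26/2 = 13 > 4π. The spare factor 2 yields 2^24 >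
  -- 120³ at the end.
  have h2b : 2 * Real.pi * (2 * b) ≤ κ * ((1 - 1 / 10) / (1 + 1 / 10) ^ 3) := by
    have : κ / 2 ≤ κ * ((1 - 1 / 10) / (1 + 1 / 10) ^ 3) := by
      have : 0 ≤ κ := kap_nonneg _ _ _
      rw [div_eq_mul_inv]
      gcongr
      norm_num
    nlinarith
  have h1 : (2 * Real.pi * (2 * b)) ^ p ≤ (κ * ((1 - 1 / 10) / (1 + 1 / 10) ^ 3)) ^ p :=
    Real.rpow_le_rpow (by positivity) h2b (by linarith)
  rw [Real.mul_rpow (by positivity) (by positivity)] at h1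
  have h2 : (2 * b) ^ 24 ≤ (2 * b) ^ p := by
    rw [← Real.rpow_natCast]
    exact Real.rpow_le_rpow_of_exponent_le (by linarith) (by exact_mod_cast hp)
  have h3 : (d ^ 2 / 120) ^ 3 ≤ (1 / 10 * κ * d ^ 2 / 12) ^ 3 := by
    apply pow_le_pow_left₀ (by positivity)
    have : 1 ≤ κ := by linarith
    have := mul_le_mul_of_nonneg_right this (sq_nonneg d)
    linarith
  have hA : 0 < (2 * Real.pi) ^ p := by positivity
  have h4 : (2 * Real.pi) ^ p * (2 * b) ^ 24 * (d ^ 2 / 120) ^ 3 ≤ (2 * Real.pi) ^ p := by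
    refine le_trans ?_ hmain
    refine mul_le_mul (le_trans ?_ h1) h3 (by positivity)
      (Real.rpow_nonneg (le_trans (by positivity) h2b) _)
    exact mul_le_mul_of_nonneg_left h2 hA.le
  have h5 : (2 * b) ^ 24 * (d ^ 2 / 120) ^ 3 = 2 ^ 24 / 120 ^ 3 := by
    calc _ = (b ^ 24 * d ^ 6) * (2 ^ 24 / 120 ^ 3) := by ring
      _ = _ := by rw [hb24, one_mul]
  rw [mul_assoc, h5] at h4
  have : (1 : ℝ) < 2 ^ 24 / 120 ^ 3 := by norm_num
  nlinarith

/-- As the exponent tends to infinity, the Menger curvature of low-energy loops is asymptotically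
bounded by that of the round circle. -/
theorem exists_kap_le_of_energy {ε d : ℝ} (hε : 0 < ε) (hd : 0 < d) :
    ∃ P : ℝ, ∀ p ≥ P, 0 < p → ∀ γ : ℝ → E3, IsUnitLoop γ →
      mengerEnergy p γ ≤ ENNReal.ofReal ((2 * Real.pi) ^ p) →
      ∀ x ∈ trace γ, ∀ y ∈ trace γ, ∀ z ∈ trace γ,
        d ≤ ‖y - x‖ → d ≤ ‖z - x‖ → d ≤ ‖z - y‖ → kap x y z ≤ 2 * Real.pi * (1 + ε) := by
  have hπ := Real.pi_pos
  -- Chosen so that (1 + ε)(1 - 4η) = 1 + ε/2, while (1 - η)/(1 + η)³ ≥ 1 - 4η.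
  set η := ε / (8 * (1 + ε)) with hη
  have hη0 : 0 < η := by positivity
  have hη1 : η < 1 := by rw [hη, div_lt_one (by positivity)]; linarith
  have hηε : (1 + ε / 2) ≤ (1 + ε) * ((1 - η) / (1 + η) ^ 3) := by
    have h1 : (1 + ε) * (1 - 4 * η) = 1 + ε / 2 := by rw [hη]; field_simp; ring
    rw [← h1]
    gcongr
    rw [le_div_iff₀ (by positivity)]
    nlinarith [pow_pos hη0 2, pow_pos hη0 3, pow_pos hη0 4]
  -- A lower bound, independent of p and of the curve, for the product of the three ball lengths
  -- when κ ≥ 2π; the power (1 + ε/2)^p eventually beats 1/m.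
  set m := (η * (2 * Real.pi) * d ^ 2 / 12) ^ 3 with hm
  have hm0 : 0 < m := by positivity
  obtain ⟨N, hN⟩ := pow_unbounded_of_one_lt (1 / m) (show 1 < 1 + ε / 2 by linarith)
  refine ⟨N, fun p hpN hp γ hγ hE x hx y hy z hz hxy hxz hyz => ?_⟩
  by_contra! hlt
  have hmain := kap_rpow_mul_le hγ hp hE hx hy hz hd hη0 hη1 hxy hxz hyz
  set κ := kap x y z
  have h2 : 2 * Real.pi ≤ κ := by nlinarith
  have h3 : m ≤ (η * κ * d ^ 2 / 12) ^ 3 := by rw [hm]; gcongr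
  have hfac : 0 ≤ (1 - η) / (1 + η) ^ 3 := div_nonneg (by linarith) (by positivity)
  have h4 : 2 * Real.pi * (1 + ε / 2) ≤ κ * ((1 - η) / (1 + η) ^ 3) :=
    calc _ ≤ 2 * Real.pi * ((1 + ε) * ((1 - η) / (1 + η) ^ 3)) := by gcongr
      _ = 2 * Real.pi * (1 + ε) * ((1 - η) / (1 + η) ^ 3) := by ring
      _ ≤ _ := by gcongr
  have h5 := Real.rpow_le_rpow (by positivity) h4 hp.le
  rw [Real.mul_rpow (by positivity) (by positivity)] at h5
  have h6 : (1 + ε / 2) ^ N ≤ (1 + ε / 2) ^ p := by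
    rw [← Real.rpow_natCast]
    exact Real.rpow_le_rpow_of_exponent_le (by linarith) hpN
  have h7 : 1 < (1 + ε / 2) ^ p * m := by
    rw [← div_lt_iff₀ hm0]; exact hN.trans_le h6
  have hA : 0 < (2 * Real.pi) ^ p := by positivity
  have h8 : (2 * Real.pi) ^ p * (1 + ε / 2) ^ p * m ≤ (2 * Real.pi) ^ p :=
    (mul_le_mul h5 h3 hm0.le ((mul_nonneg hA.le (by positivity)).trans h5)).trans hmain
  nlinarith

theorem IsMengerMinimizer.energy_le {p : ℝ} (hp : 0 < p) {γ : ℝ → E3} (h : IsMengerMinimizer p γ) :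
    mengerEnergy p γ ≤ ENNReal.ofReal ((2 * Real.pi) ^ p) :=
  (h.2 _ isUnitLoop_unitCircleLoop).trans (mengerEnergy_unitCircleLoop_le hp)

/-! ### Flatness of loops with controlled Menger curvature -/

/-- The sine of the angle between the lines spanned by two vectors. -/
noncomputable def sn (a b : E3) : ℝ := ‖cr a b‖ / (‖a‖ * ‖b‖)

theorem sn_comm (a b : E3) : sn a b = sn b a := by
  rw [sn, sn, norm_cr_comm, mul_comm]

theorem sn_neg_right (a b : E3) : sn a (-b) = sn a b := by
  have : cr a (-b) = -cr a b := by rw [← neg_one_smul ℝ b, cr_smul_right, neg_one_smul]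
  rw [sn, sn, this, norm_neg, norm_neg]

theorem sn_neg_left (a b : E3) : sn (-a) b = sn a b := by
  rw [sn_comm, sn_neg_right, sn_comm]

/-- Split c into its component along b and the orthogonal rest, whose norm is ‖b × c‖/‖b‖; the first
part contributes at most the sine of (a, b), the second at most that of (b, c). -/
theorem sn_triangle {a b c : E3} (hb : b ≠ 0) : sn a c ≤ sn a b + sn b c := by
  have hb' : 0 < ‖b‖ := norm_pos_iff.2 hb
  rcases eq_or_ne a 0 with rfl | ha
  · have : sn 0 c = 0 := by simp [sn]
    rw [this]; unfold sn; positivity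
  rcases eq_or_ne c 0 with rfl | hc
  · have : sn a 0 = 0 := by simp [sn]
    rw [this]; unfold sn; positivity
  have ha' : 0 < ‖a‖ := norm_pos_iff.2 ha
  have hc' : 0 < ‖c‖ := norm_pos_iff.2 hc
  have h1 : ‖b‖ ^ 2 • cr a c = inner ℝ b c • cr a b + cr a (‖b‖ ^ 2 • c - inner ℝ b c • b) := by
    rw [cr_sub_right, cr_smul_right, cr_smul_right]; abel
  have h2 : ‖‖b‖ ^ 2 • c - inner ℝ b c • b‖ = ‖b‖ * ‖cr b c‖ := by
    rw [← pow_left_inj₀ (norm_nonneg _) (by positivity) two_ne_zero, mul_pow, norm_cr_sq,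
      norm_sub_sq_real, norm_smul, norm_smul, real_inner_smul_left, real_inner_smul_right,
      real_inner_comm b c, Real.norm_eq_abs, Real.norm_eq_abs, mul_pow, mul_pow, sq_abs, sq_abs]
    rw [real_inner_comm c b]
    ring
  have h3 : ‖b‖ ^ 2 * ‖cr a c‖ ≤ ‖b‖ * ‖c‖ * ‖cr a b‖ + ‖a‖ * (‖b‖ * ‖cr b c‖) := by
    have h4 := norm_add_le (inner ℝ b c • cr a b) (cr a (‖b‖ ^ 2 • c - inner ℝ b c • b))
    rw [← h1, norm_smul, norm_smul, Real.norm_of_nonneg (by positivity)] at h4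
    have h5 := norm_cr_le a (‖b‖ ^ 2 • c - inner ℝ b c • b)
    rw [h2] at h5
    have h6 := mul_le_mul_of_nonneg_right (norm_inner_le_norm (𝕜 := ℝ) b c) (norm_nonneg (cr a b))
    linarith
  have h4 : ‖b‖ * ‖cr a c‖ ≤ ‖c‖ * ‖cr a b‖ + ‖a‖ * ‖cr b c‖ := by
    have : ‖b‖ * (‖b‖ * ‖cr a c‖) ≤ ‖b‖ * (‖c‖ * ‖cr a b‖ + ‖a‖ * ‖cr b c‖) := by linarith
    exact le_of_mul_le_mul_left this hb'
  have h5 : sn a b + sn b c = (‖c‖ * ‖cr a b‖ + ‖a‖ * ‖cr b c‖) / (‖b‖ * (‖a‖ * ‖c‖)) := by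
    unfold sn; field_simp
  have h6 : sn a c = (‖b‖ * ‖cr a c‖) / (‖b‖ * (‖a‖ * ‖c‖)) := by
    unfold sn; field_simp
  rw [h5, h6]
  gcongr

theorem sn_eq_kap {x y z : E3} (h : z ≠ y) :
    sn (y - x) (z - x) = kap x y z * ‖z - y‖ / 2 := by
  have : ‖z - y‖ ≠ 0 := norm_ne_zero_iff.2 (sub_ne_zero.2 h)
  rcases eq_or_ne (y - x) 0 with h1 | h1
  · simp [sn, kap, h1]
  rcases eq_or_ne (z - x) 0 with h2 | h2
  · simp [sn, kap, h2]
  have h1 := norm_ne_zero_iff.2 h1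
  have h2 := norm_ne_zero_iff.2 h2
  unfold sn kap
  field_simp

theorem inner_sq_add_norm_cr_sq {e : E3} (he : ‖e‖ = 1) (v : E3) :
    inner ℝ e v ^ 2 + ‖cr e v‖ ^ 2 = ‖v‖ ^ 2 := by
  rw [norm_cr_sq, he]; ring

theorem rpow_quarter_bound {D : ℝ} (hD : 0 < D) :
    (D / 4) ^ (-(1 / 4) : ℝ) * D ≤ 3 / 2 * D ^ (3 / 4 : ℝ) := by
  have h1 : D ^ (-(1 / 4) : ℝ) * D = D ^ (3 / 4 : ℝ) := by
    conv_lhs => rw [← Real.rpow_one D, ← Real.rpow_mul hD.le, ← Real.rpow_add hD]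
    norm_num
  have h2 : ((4 : ℝ)⁻¹) ^ (-(1 / 4) : ℝ) ≤ 3 / 2 := by
    rw [Real.rpow_neg (by norm_num), Real.inv_rpow (by norm_num), inv_inv]
    refine (Real.rpow_le_rpow (by norm_num) (show (4 : ℝ) ≤ (3 / 2) ^ (4 : ℕ) by norm_num)
      (by norm_num)).trans ?_
    rw [← Real.rpow_natCast, ← Real.rpow_mul (by norm_num)]
    norm_num
  rw [div_eq_mul_inv, Real.mul_rpow hD.le (by norm_num)]
  have h3 : 0 ≤ D ^ (3 / 4 : ℝ) := by positivity
  calc _ = (4⁻¹ : ℝ) ^ (-(1 / 4) : ℝ) * (D ^ (-(1 / 4) : ℝ) * D) := by ring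
    _ ≤ _ := by rw [h1]; gcongr

theorem rpow_half_bound {D : ℝ} (hD : 0 < D) : (D / 2) ^ (3 / 4 : ℝ) ≤ 2 / 3 * D ^ (3 / 4 : ℝ) := by
  have h2 : ((2 : ℝ)⁻¹) ^ (3 / 4 : ℝ) ≤ 2 / 3 := by
    have h : ((2 : ℝ)⁻¹) ^ (3 / 4 : ℝ) = ((2 : ℝ)⁻¹ ^ 3) ^ (1 / 4 : ℝ) := by
      rw [← Real.rpow_natCast, ← Real.rpow_mul (by norm_num)]
      norm_num
    rw [h]
    refine (Real.rpow_le_rpow (by norm_num) (show ((2 : ℝ)⁻¹ ^ 3) ≤ (2 / 3) ^ (4 : ℕ) by norm_num)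
      (by norm_num)).trans ?_
    rw [← Real.rpow_natCast, ← Real.rpow_mul (by norm_num)]
    norm_num
  rw [div_eq_mul_inv, Real.mul_rpow hD.le (by norm_num), mul_comm]
  gcongr

/-- The Menger curvature of triples in `S` is at most `M d ^ (-1/4)`, where `d` bounds the mutual
distances from below. -/
def KapBound (M : ℝ) (S : Set E3) : Prop :=
  ∀ x ∈ S, ∀ y ∈ S, ∀ z ∈ S, ∀ d > 0, d ≤ ‖y - x‖ → d ≤ ‖z - x‖ → d ≤ ‖z - y‖ →
    kap x y z ≤ M * d ^ (-(1 / 4) : ℝ)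

theorem exists_norm_sub_eq {S : Set E3} (hS : IsPreconnected S) {u w : E3} (hu : u ∈ S)
    (hw : w ∈ S) {r : ℝ} (hr : 0 ≤ r) (hrw : r ≤ ‖w - u‖) : ∃ v ∈ S, ‖v - u‖ = r := by
  have hc : ContinuousOn (fun v : E3 => ‖v - u‖) S := by fun_prop
  exact hS.intermediate_value hu hw hc ⟨by simpa using hr, hrw⟩

/-! ### Angles between secants at small scales -/

section directions

variable {S : Set E3} {M : ℝ}

/-- At comparable scales all three sides are at least a quarter of the longest distance D from u, so
the law of sines and the curvature bound give a sine of order D · D^(-1/4). -/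
theorem KapBound.sn_le_of_comparable (h : KapBound M S) (hM : 0 ≤ M) {u v w : E3} (hu : u ∈ S)
    (hv : v ∈ S) (hw : w ∈ S) (hvu : v ≠ u) (h1 : 2 * ‖v - u‖ ≤ ‖w - u‖)
    (h2 : ‖w - u‖ ≤ 4 * ‖v - u‖) : sn (v - u) (w - u) ≤ 2 * M * ‖w - u‖ ^ (3 / 4 : ℝ) := by
  have hv0 : 0 < ‖v - u‖ := norm_pos_iff.2 (sub_ne_zero.2 hvu)
  have hD : 0 < ‖w - u‖ := by linarith
  have e1 : w - u = (w - v) + (v - u) := by abel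
  have e2 : w - v = (w - u) - (v - u) := by abel
  have h3 := norm_add_le (w - v) (v - u)
  rw [← e1] at h3
  have h4 := norm_sub_le (w - u) (v - u)
  rw [← e2] at h4
  have hwv : w ≠ v := by
    rintro rfl
    linarith
  rw [sn_eq_kap hwv]
  have hk := h u hu v hv w hw (‖w - u‖ / 4) (by positivity) (by linarith) (by linarith)
    (by linarith)
  have h5 := rpow_quarter_bound hD
  have h6 : 0 ≤ ‖w - u‖ ^ (3 / 4 : ℝ) := by positivity
  calc kap u v w * ‖w - v‖ / 2
      ≤ (M * (‖w - u‖ / 4) ^ (-(1 / 4) : ℝ)) * (3 / 2 * ‖w - u‖) / 2 := by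
        gcongr
        linarith
    _ = 3 / 4 * M * ((‖w - u‖ / 4) ^ (-(1 / 4) : ℝ) * ‖w - u‖) := by ring
    _ ≤ 3 / 4 * M * (3 / 2 * ‖w - u‖ ^ (3 / 4 : ℝ)) := by gcongr
    _ = 9 / 8 * M * ‖w - u‖ ^ (3 / 4 : ℝ) := by ring
    _ ≤ _ := by gcongr; norm_num

/-- Pass from the scale of w down to that of v by halvings; the errors form a geometric series. -/
theorem KapBound.sn_le_of_two_mul_le (h : KapBound M S) (hM : 0 ≤ M) (hS : IsPreconnected S)
    {u v w : E3} (hu : u ∈ S) (hv : v ∈ S) (hw : w ∈ S) (hvu : v ≠ u)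
    (h1 : 2 * ‖v - u‖ ≤ ‖w - u‖) : sn (v - u) (w - u) ≤ 6 * M * ‖w - u‖ ^ (3 / 4 : ℝ) := by
  have hv0 : 0 < ‖v - u‖ := norm_pos_iff.2 (sub_ne_zero.2 hvu)
  obtain ⟨n, hn⟩ := pow_unbounded_of_one_lt (‖w - u‖ / ‖v - u‖) one_lt_two
  rw [div_lt_iff₀ hv0] at hn
  induction n generalizing w with
  | zero => linarith
  | succ n ih =>
    have hD : 0 < ‖w - u‖ := by linarith
    have hD' : 0 ≤ ‖w - u‖ ^ (3 / 4 : ℝ) := by positivity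
    rcases le_total ‖w - u‖ (4 * ‖v - u‖) with h2 | h2
    · refine (h.sn_le_of_comparable hM hu hv hw hvu h1 h2).trans ?_
      gcongr
      norm_num
    -- Connectedness provides a point at half the distance. Since (1/2)^(3/4) ≤ 2/3, the constant 6
    -- reproduces itself: 6 · 2/3 + 2 = 6.
    · obtain ⟨w', hw', hr⟩ := exists_norm_sub_eq hS hu hw (r := ‖w - u‖ / 2) (by positivity)
        (by linarith)
      have hwu' : w' - u ≠ 0 := by
        rw [← norm_pos_iff, hr]; positivity
      have h3 := ih hw' (by linarith) (by rw [pow_succ] at hn; linarith)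
      have h4 := h.sn_le_of_comparable hM hu hw' hw (sub_ne_zero.1 hwu') (by linarith)
        (by linarith)
      have h5 := rpow_half_bound hD
      rw [← hr] at h5
      have h6 := mul_le_mul_of_nonneg_left h5 hM
      have := sn_triangle (a := v - u) (c := w - u) hwu'
      linarith

theorem KapBound.sn_le (h : KapBound M S) (hM : 0 ≤ M) (hS : IsPreconnected S)
    {u v w : E3} (hu : u ∈ S) (hv : v ∈ S) (hw : w ∈ S) (hvu : v ≠ u) (hwu : w ≠ u) {D : ℝ}
    (h1 : ‖v - u‖ ≤ D) (h2 : ‖w - u‖ ≤ D) :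
    sn (v - u) (w - u) ≤ 12 * M * D ^ (3 / 4 : ℝ) := by
  have hv0 : 0 < ‖v - u‖ := norm_pos_iff.2 (sub_ne_zero.2 hvu)
  have hw0 : 0 < ‖w - u‖ := norm_pos_iff.2 (sub_ne_zero.2 hwu)
  set r := min ‖v - u‖ ‖w - u‖ with hr
  have hr0 : 0 < r := lt_min hv0 hw0
  have hrv : r ≤ ‖v - u‖ := min_le_left _ _
  have hrw : r ≤ ‖w - u‖ := min_le_right _ _
  -- A common reference point closer to u than both v and w, so that the dyadic estimate applies to
  -- each; the constant doubles to 12.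
  obtain ⟨x, hx, hxr⟩ := exists_norm_sub_eq hS hu hv (r := r / 2) (by positivity) (by linarith)
  have hxu : x - u ≠ 0 := by
    rw [← norm_pos_iff, hxr]; positivity
  have h3 := h.sn_le_of_two_mul_le hM hS hu hx hv (sub_ne_zero.1 hxu) (by linarith)
  have h4 := h.sn_le_of_two_mul_le hM hS hu hx hw (sub_ne_zero.1 hxu) (by linarith)
  rw [sn_comm] at h3
  have h5 := sn_triangle (a := v - u) (c := w - u) hxu
  have h6 : 6 * M * ‖v - u‖ ^ (3 / 4 : ℝ) ≤ 6 * M * D ^ (3 / 4 : ℝ) := by gcongr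
  have h7 : 6 * M * ‖w - u‖ ^ (3 / 4 : ℝ) ≤ 6 * M * D ^ (3 / 4 : ℝ) := by gcongr
  linarith

/-- Two secants without a common endpoint are compared through the secant from u to v', which shares
an endpoint with each; the case v' = u is direct. -/
theorem KapBound.sn_sub_sub_le (h : KapBound M S) (hM : 0 ≤ M) (hS : IsPreconnected S)
    {T : Set E3} (hT : T ⊆ S) {D : ℝ} (hTD : ∀ x ∈ T, ∀ y ∈ T, ‖x - y‖ ≤ D) {u v u' v' : E3}
    (hu : u ∈ T) (hv : v ∈ T) (hu' : u' ∈ T) (hv' : v' ∈ T) (hvu : v ≠ u) (hvu' : v' ≠ u') :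
    sn (v - u) (v' - u') ≤ 24 * M * D ^ (3 / 4 : ℝ) := by
  have hD : 0 ≤ D := (norm_nonneg _).trans (hTD u hu v hv)
  have hD' : 0 ≤ M * D ^ (3 / 4 : ℝ) := by positivity
  by_cases huv : v' = u
  · subst huv
    have := h.sn_le hM hS (hT hv') (hT hv) (hT hu') hvu hvu'.symm (hTD _ hv _ hv')
      (hTD _ hu' _ hv')
    rw [← neg_sub u' v', sn_neg_right]
    linarith
  · have h1 := h.sn_le hM hS (hT hu) (hT hv) (hT hv') hvu huv (hTD _ hv _ hu) (hTD _ hv' _ hu)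
    have h2 := h.sn_le hM hS (hT hv') (hT hu) (hT hu') (Ne.symm huv) hvu'.symm (hTD _ hu _ hv')
      (hTD _ hu' _ hv')
    rw [← neg_sub v' u, ← neg_sub v' u', sn_neg_left, sn_neg_right] at h2
    have := sn_triangle (a := v - u) (c := v' - u') (sub_ne_zero.2 huv)
    linarith

end directions

theorem IsLoop.not_eqOn_const {g : ℝ → E3} (hg : IsLoop g) {s t : ℝ} (hst : s < t) (ht : t ≤ s + 1)
    (h : ∀ x ∈ Icc s t, g x = g s) : False := by
  have h0 := hg.volume_eq_zero_of_image_subset (A := Ico s ((s + t) / 2))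
    (B := Ico ((s + t) / 2) t) (a := s) measurableSet_Ico measurableSet_Ico
    (Ico_subset_Ico_right (by linarith)) (Ico_subset_Ico (by linarith) ht)
    (by
      rw [Set.disjoint_left]
      intro x hx hx'
      exact absurd hx.2 (not_lt.2 hx'.1))
    (by
      rintro _ ⟨x, hx, rfl⟩
      refine ⟨(s + t) / 2, ⟨le_rfl, by linarith⟩, ?_⟩
      rw [h x ⟨hx.1, by linarith [hx.2]⟩, h _ ⟨by linarith, by linarith⟩])
  rw [Real.volume_Ico, ENNReal.ofReal_eq_zero] at h0
  linarith

/-- If f rises and comes back, the values just taken on the way up recur on the way down. As g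
depends only on f, a nonempty open set of parameters would be retraced. -/
theorem IsLoop.not_fold {g : ℝ → E3} (hg : IsLoop g) {f : ℝ → ℝ} (hf : Continuous f) {s m t : ℝ}
    (hsm : s < m) (hmt : m < t) (ht : t < s + 1)
    (hfg : ∀ x ∈ Icc s t, ∀ y ∈ Icc s t, f x = f y → g x = g y) (hst : f s = f t)
    (hfm : f s < f m) : False := by
  set A := Ioo s m ∩ f ⁻¹' Ioo (f s) (f m) with hA
  have hAo : IsOpen A := isOpen_Ioo.inter (isOpen_Ioo.preimage hf)
  have hAn : A.Nonempty := by
    obtain ⟨c, hc⟩ := exists_between hfm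
    obtain ⟨x, hx, hxc⟩ := intermediate_value_Ioo hsm.le hf.continuousOn hc
    exact ⟨x, hx, by rw [mem_preimage, hxc]; exact hc⟩
  have h0 := hg.volume_eq_zero_of_image_subset (A := A) (B := Icc m t) (a := s) hAo.measurableSet
    measurableSet_Icc (fun x hx => ⟨hx.1.1.le, by linarith [hx.1.2]⟩)
    (fun x hx => ⟨by linarith [hx.1], by linarith [hx.2]⟩)
    (by
      rw [Set.disjoint_left]
      intro x hx hx'
      exact absurd hx.1.2 (not_lt.2 hx'.1))
    (by
      rintro _ ⟨x, hx, rfl⟩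
      obtain ⟨y, hy, hyx⟩ := intermediate_value_Icc' hmt.le hf.continuousOn
        (show f x ∈ Icc (f t) (f m) from ⟨hst ▸ hx.2.1.le, hx.2.2.le⟩)
      exact ⟨y, hy, hfg y ⟨by linarith [hy.1], hy.2⟩ x ⟨hx.1.1.le, by linarith [hx.1.2]⟩ hyx⟩)
  exact (hAo.measure_pos volume hAn).ne' h0

/-- A function through which a loop factors on a short interval is injective there. -/
theorem IsLoop.injOn_of_factors {g : ℝ → E3} (hg : IsLoop g) {f : ℝ → ℝ} (hf : Continuous f)
    {a b : ℝ} (hb : b < a + 1)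
    (hfg : ∀ x ∈ Icc a b, ∀ y ∈ Icc a b, f x = f y → g x = g y) : InjOn f (Icc a b) := by
  have key : ∀ s ∈ Icc a b, ∀ t ∈ Icc a b, s < t → f s ≠ f t := by
    intro s hs t ht hst he
    have hsub : Icc s t ⊆ Icc a b := Icc_subset_Icc hs.1 ht.2
    have ht1 : t < s + 1 := by linarith [hs.1, ht.2]
    by_cases hc : ∀ x ∈ Icc s t, f x = f s
    · exact hg.not_eqOn_const hst ht1.le fun x hx => hfg x (hsub hx) s hs (hc x hx)
    · push Not at hc
      obtain ⟨m, hm, hne⟩ := hc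
      have hsm : s < m := lt_of_le_of_ne hm.1 (by rintro rfl; exact hne rfl)
      have hmt : m < t := lt_of_le_of_ne hm.2 (by rintro rfl; exact hne he.symm)
      rcases lt_or_gt_of_ne hne with h | h
      · exact hg.not_fold hf.neg hsm hmt ht1
          (fun x hx y hy hxy => hfg x (hsub hx) y (hsub hy) (neg_injective hxy))
          (by simpa using he) (by simpa using h)
      · exact hg.not_fold hf hsm hmt ht1
          (fun x hx y hy hxy => hfg x (hsub hx) y (hsub hy) hxy) he h
  intro s hs t ht he
  rcases lt_trichotomy s t with h | h | h
  · exact absurd he (key s hs t ht h)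
  · exact h
  · exact absurd he.symm (key t ht s hs h)

/-- On every short interval the curve moves almost with unit speed in one direction. -/
def IsFlat (K D₀ : ℝ) (g : ℝ → E3) : Prop :=
  ∀ a D, 0 < D → D ≤ D₀ → ∃ e : E3, ‖e‖ = 1 ∧
    ∀ s t, a ≤ s → s ≤ t → t ≤ a + D → (1 - K * D ^ (3 / 2 : ℝ)) * (t - s) ≤ inner ℝ e (g t - g s)

/-- Let e be the direction of any nonzero secant. All secants are nearly parallel to e, so g is a
Lipschitz function of the projection f = ⟨e, g⟩; absence of folds makes f injective, hence monotone,
increasing after a possible change of sign of e. An arc of duration t - s has length at least t - s,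
which bounds f(t) - f(s) from below. -/
theorem IsLoop.exists_direction {g : ℝ → E3} (hg : IsLoop g) {a b ε : ℝ} (hab : a < b)
    (hb : b < a + 1) (hε2 : ε ^ 2 ≤ 1 / 2)
    (h : ∀ u ∈ g '' Icc a b, ∀ v ∈ g '' Icc a b, ∀ u' ∈ g '' Icc a b, ∀ v' ∈ g '' Icc a b,
      v ≠ u → v' ≠ u' → sn (v - u) (v' - u') ≤ ε) :
    ∃ e : E3, ‖e‖ = 1 ∧ ∀ s t, a ≤ s → s ≤ t → t ≤ b →
      (1 - ε ^ 2) * (t - s) ≤ inner ℝ e (g t - g s) := by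
  obtain ⟨t₀, ht₀, hne⟩ : ∃ t₀ ∈ Icc a b, g t₀ ≠ g a := by
    by_contra! hc
    exact hg.not_eqOn_const hab hb.le hc
  have haA : g a ∈ g '' Icc a b := ⟨a, ⟨le_rfl, hab.le⟩, rfl⟩
  set w := g t₀ - g a with hw
  have hw0 : 0 < ‖w‖ := norm_pos_iff.2 (sub_ne_zero.2 hne)
  set e := ‖w‖⁻¹ • w with he
  have he1 : ‖e‖ = 1 := by
    rw [he, norm_smul, norm_inv, norm_norm, inv_mul_cancel₀ hw0.ne']
  have hcr : ∀ s ∈ Icc a b, ∀ t ∈ Icc a b, ‖cr e (g t - g s)‖ ≤ ε * ‖g t - g s‖ := by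
    intro s hs t ht
    by_cases hst : g t = g s
    · have := norm_cr_le e (g t - g s)
      rw [hst, sub_self, norm_zero, mul_zero] at *
      exact this
    · have h1 := h _ haA _ ⟨t₀, ht₀, rfl⟩ _ ⟨s, hs, rfl⟩ _ ⟨t, ht, rfl⟩ hne hst
      rw [sn, div_le_iff₀ (mul_pos hw0 (norm_pos_iff.2 (sub_ne_zero.2 hst))), ← hw] at h1
      rw [he, cr_smul_left, norm_smul, norm_inv, norm_norm, inv_mul_le_iff₀ hw0]
      linarith
  have hinner : ∀ s ∈ Icc a b, ∀ t ∈ Icc a b,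
      ‖g t - g s‖ ≤ (1 + ε ^ 2) * |inner ℝ e (g t - g s)| := by
    intro s hs t ht
    have h1 := inner_sq_add_norm_cr_sq he1 (g t - g s)
    have h2 := pow_le_pow_left₀ (norm_nonneg _) (hcr s hs t ht) 2
    have h3 : (1 - ε ^ 2) * ‖g t - g s‖ ^ 2 ≤ inner ℝ e (g t - g s) ^ 2 := by
      rw [mul_pow] at h2; linarith
    apply le_of_sq_le_sq _ (by positivity)
    rw [mul_pow, sq_abs]
    -- This turns the cosine bound √(1 - ε²) into the factor 1 + ε²; it is where ε² ≤ 1/2 enters.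
    have h4 : 1 ≤ (1 + ε ^ 2) ^ 2 * (1 - ε ^ 2) := by
      have h5 : 0 ≤ ε ^ 2 * (1 - ε ^ 2 - (ε ^ 2) ^ 2) :=
        mul_nonneg (sq_nonneg ε) (by nlinarith [sq_nonneg ε])
      linarith
    calc ‖g t - g s‖ ^ 2 ≤ ((1 + ε ^ 2) ^ 2 * (1 - ε ^ 2)) * ‖g t - g s‖ ^ 2 :=
          le_mul_of_one_le_left (sq_nonneg _) h4
      _ = (1 + ε ^ 2) ^ 2 * ((1 - ε ^ 2) * ‖g t - g s‖ ^ 2) := by ring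
      _ ≤ _ := by gcongr
  have hmono : ∀ e' : E3, (∀ s ∈ Icc a b, ∀ t ∈ Icc a b,
      ‖g t - g s‖ ≤ (1 + ε ^ 2) * |inner ℝ e' (g t - g s)|) →
      StrictMonoOn (fun x => inner ℝ e' (g x)) (Icc a b) → ∀ s t, a ≤ s → s ≤ t → t ≤ b →
        (1 - ε ^ 2) * (t - s) ≤ inner ℝ e' (g t - g s) := by
    intro e' hle hmo s t has hst htb
    have hsub : Ico s t ⊆ Icc a b := fun x hx => ⟨has.trans hx.1, hx.2.le.trans htb⟩
    set f : ℝ → ℝ := fun x => inner ℝ e' (g x) with hf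
    have hK := hausdorffMeasure_image_le_of_dist_le (φ := g) (ψ := f) (A := Ico s t)
      (K := (1 + ε ^ 2).toNNReal) fun x hx y hy => by
        rw [dist_eq_norm, dist_eq_norm, Real.norm_eq_abs, hf,
          Real.coe_toNNReal _ (by positivity)]
        simp only [← inner_sub_right]
        exact hle y (hsub hy) x (hsub hx)
    have h1 := hg.volume_le_hausdorff_image (A := Ico s t) measurableSet_Ico (a := s)
      (Ico_subset_Ico_right (by linarith))
    have h2 : f '' Ico s t ⊆ Icc (f s) (f t) := by
      rintro _ ⟨x, hx, rfl⟩
      exact ⟨hmo.monotoneOn ⟨has, hst.trans htb⟩ (hsub hx) hx.1,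
        hmo.monotoneOn (hsub hx) ⟨has.trans hst, htb⟩ hx.2.le⟩
    have h3 : Measure.hausdorffMeasure 1 (f '' Ico s t) ≤ ENNReal.ofReal (f t - f s) := by
      rw [hausdorffMeasure_real, ← Real.volume_Icc]; exact measure_mono h2
    have hfst : f s ≤ f t := hmo.monotoneOn ⟨has, hst.trans htb⟩ ⟨has.trans hst, htb⟩ hst
    have h4 : ENNReal.ofReal (t - s) ≤ ENNReal.ofReal ((1 + ε ^ 2) * (f t - f s)) := by
      rw [← Real.volume_Ico, ENNReal.ofReal_mul (by positivity)]
      refine h1.trans (hK.trans ?_)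
      change ENNReal.ofReal _ * _ ≤ _
      gcongr
    rw [ENNReal.ofReal_le_ofReal_iff (mul_nonneg (by positivity) (by linarith))] at h4
    rw [inner_sub_right]
    change _ ≤ f t - f s
    have h6 := mul_le_mul_of_nonneg_left h4 (show 0 ≤ 1 - ε ^ 2 by linarith)
    nlinarith [sq_nonneg (ε ^ 2)]
  have hfc : Continuous fun x => inner ℝ e (g x) := by
    have := hg.continuous
    fun_prop
  have hinj : InjOn (fun x => inner ℝ e (g x)) (Icc a b) :=
    hg.injOn_of_factors hfc hb fun x hx y hy hxy => by
      have h1 := hinner y hy x hx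
      change inner ℝ e (g x) = inner ℝ e (g y) at hxy
      rw [inner_sub_right, hxy, sub_self, abs_zero, mul_zero] at h1
      exact sub_eq_zero.1 (norm_le_zero_iff.1 h1)
  rcases hfc.continuousOn.strictMonoOn_of_injOn_Icc' hab.le hinj with hm | hm
  · exact ⟨e, he1, hmono e hinner hm⟩
  · refine ⟨-e, by rwa [norm_neg], hmono (-e) (fun s hs t ht => ?_) fun x hx y hy hxy => ?_⟩
    · rw [inner_neg_left, abs_neg]; exact hinner s hs t ht
    · have := hm hx hy hxy
      simp only [inner_neg_left] at this ⊢
      linarith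

theorem IsLoop.isFlat {g : ℝ → E3} (hg : IsLoop g) {M D₀ : ℝ} (hM : 0 ≤ M)
    (h : KapBound M (range g)) (hD₀ : D₀ < 1) (hMD : 24 * M * D₀ ^ (3 / 4 : ℝ) ≤ 1 / 2) :
    IsFlat (576 * M ^ 2) D₀ g := by
  intro a D hD hDD
  have hD' : 24 * M * D ^ (3 / 4 : ℝ) ≤ 1 / 2 := by
    refine le_trans ?_ hMD
    gcongr
  have h0 : 0 ≤ 24 * M * D ^ (3 / 4 : ℝ) := by positivity
  have hsq : (24 * M * D ^ (3 / 4 : ℝ)) ^ 2 = 576 * M ^ 2 * D ^ (3 / 2 : ℝ) := by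
    rw [mul_pow, mul_pow, ← Real.rpow_natCast (D ^ (3 / 4 : ℝ)), ← Real.rpow_mul hD.le]
    norm_num
  rw [← hsq]
  refine hg.exists_direction (by linarith) (by linarith) (by nlinarith)
    fun u hu v hv u' hu' v' hv' hvu hvu' => ?_
  refine h.sn_sub_sub_le hM (isPreconnected_range hg.continuous) (image_subset_range g _) ?_
    hu hv hu' hv' hvu hvu'
  rintro _ ⟨s, hs, rfl⟩ _ ⟨t, ht, rfl⟩
  refine (hg.lip s t).trans ?_
  rw [abs_le]
  constructor <;> linarith [hs.1, hs.2, ht.1, ht.2]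

/-! ### Rigidity: closed curves of length one with Menger curvature at most `2π` -/

open Filter Topology

/-! ### First and second differences of flat curves -/

section Flat

variable {g : ℝ → E3} {K D₀ : ℝ}

theorem IsFlat.le_norm_sub (h : IsFlat K D₀ g) {s r : ℝ} (hr : 0 < r) (hrD : r ≤ D₀) :
    (1 - K * r ^ (3 / 2 : ℝ)) * r ≤ ‖g (s + r) - g s‖ := by
  obtain ⟨e, he, H⟩ := h s r hr hrD
  have h1 := H s (s + r) le_rfl (by linarith) le_rfl
  have h2 := real_inner_le_norm e (g (s + r) - g s)
  rw [he, one_mul] at h2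
  rw [add_sub_cancel_left] at h1
  exact h1.trans h2

/-- Write ‖b - a‖² = (‖a‖ - ‖b‖)² + 2(‖a‖‖b‖ - ⟨a, b⟩). The first term is at most θ²h²; in the
second, Lagrange's identity factors ‖a × b‖² as the difference times the sum ‖a‖‖b‖ + ⟨a, b⟩, which
is at least 2(1 - 4θ)h². -/
theorem norm_sub_sq_le_of_cr {a b : E3} {h θ : ℝ} (hh : 0 < h) (hθ : 4 * θ < 1)
    (ha : ‖a‖ ≤ h) (hb : ‖b‖ ≤ h) (ha' : (1 - θ) * h ≤ ‖a‖) (hb' : (1 - θ) * h ≤ ‖b‖)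
    (hab : 2 * (1 - θ) * h ≤ ‖a + b‖) (hcr : ‖cr a b‖ ≤ 2 * Real.pi * h ^ 3) :
    ‖b - a‖ ^ 2 ≤ θ ^ 2 * h ^ 2 + 4 * Real.pi ^ 2 / (1 - 4 * θ) * h ^ 4 := by
  have hpos : 0 < 1 - 4 * θ := by linarith
  have h1 : 4 * (1 - θ) ^ 2 * h ^ 2 ≤ ‖a + b‖ ^ 2 := by
    have := pow_le_pow_left₀ (mul_nonneg (by linarith) hh.le) hab 2
    linarith
  have ha2 : ‖a‖ ^ 2 ≤ h ^ 2 := pow_le_pow_left₀ (norm_nonneg _) ha 2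
  have hb2 : ‖b‖ ^ 2 ≤ h ^ 2 := pow_le_pow_left₀ (norm_nonneg _) hb 2
  rw [norm_add_sq_real] at h1
  have h2 : (1 - 4 * θ) * h ^ 2 ≤ inner ℝ a b := by nlinarith [mul_nonneg (sq_nonneg θ) (sq_nonneg h)]
  have h3 : (1 - 4 * θ) * h ^ 2 ≤ ‖a‖ * ‖b‖ := h2.trans (real_inner_le_norm a b)
  have h4 : (‖a‖ * ‖b‖ - inner ℝ a b) * (‖a‖ * ‖b‖ + inner ℝ a b) ≤ 4 * Real.pi ^ 2 * h ^ 6 := by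
    have := pow_le_pow_left₀ (norm_nonneg _) hcr 2
    rw [norm_cr_sq] at this
    linarith
  have h5 : 0 ≤ ‖a‖ * ‖b‖ - inner ℝ a b := sub_nonneg.2 (real_inner_le_norm a b)
  have h6 : 2 * (‖a‖ * ‖b‖ - inner ℝ a b) ≤ 4 * Real.pi ^ 2 / (1 - 4 * θ) * h ^ 4 := by
    have h7 : (‖a‖ * ‖b‖ - inner ℝ a b) * (2 * ((1 - 4 * θ) * h ^ 2)) ≤ 4 * Real.pi ^ 2 * h ^ 6 :=
      (mul_le_mul_of_nonneg_left (by linarith) h5).trans h4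
    rw [div_mul_eq_mul_div, le_div_iff₀ hpos]
    have hh2 : 0 < h ^ 2 := by positivity
    refine le_of_mul_le_mul_right (le_trans (le_of_eq (by ring)) (h7.trans (le_of_eq (by ring)))) hh2
  have h8 : (‖a‖ - ‖b‖) ^ 2 ≤ θ ^ 2 * h ^ 2 := by
    rw [← mul_pow, ← sq_abs]
    apply pow_le_pow_left₀ (abs_nonneg _)
    rw [abs_le]
    constructor <;> linarith
  rw [norm_sub_sq_real, real_inner_comm]
  linarith

/-- The Menger curvature of a curve is at most that of the circle of length one. -/
def KapLeTwoPi (g : ℝ → E3) : Prop :=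
  ∀ s t u, g t ≠ g s → g u ≠ g s → g u ≠ g t → kap (g s) (g t) (g u) ≤ 2 * Real.pi

/-- Consecutive chords a, b satisfy 2‖a × b‖ = κ‖a‖‖b‖‖a + b‖ ≤ 4πr³. Flatness has θ of order
r^(3/2), so the length discrepancy θ²r² is of order r⁵, negligible against r⁴. -/
theorem IsFlat.second_difference_le (h : IsFlat K D₀ g) (hK : 0 ≤ K)
    (hl : ∀ s t, ‖g s - g t‖ ≤ |s - t|) (hκ : KapLeTwoPi g) {r : ℝ} (hr : 0 < r)
    (hrD : 2 * r ≤ D₀) (hθ : 4 * (K * (2 * r) ^ (3 / 2 : ℝ)) < 1) (s : ℝ) :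
    ‖(g (s + r) - g s) - (g s - g (s - r))‖ ^ 2 ≤
      (8 * K ^ 2 * r + 4 * Real.pi ^ 2 / (1 - 4 * (K * (2 * r) ^ (3 / 2 : ℝ)))) * r ^ 4 := by
  set θ := K * (2 * r) ^ (3 / 2 : ℝ) with hθd
  have hθ0 : 0 ≤ θ := by positivity
  have hθ2 : θ ^ 2 = K ^ 2 * (8 * r ^ 3) := by
    rw [hθd, mul_pow, ← Real.rpow_natCast ((2 * r) ^ (3 / 2 : ℝ)), ← Real.rpow_mul (by positivity)]
    have : (3 / 2 : ℝ) * (2 : ℕ) = (3 : ℕ) := by norm_num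
    rw [this, Real.rpow_natCast]
    ring
  obtain ⟨e, he, H⟩ := h (s - r) (2 * r) (by positivity) hrD
  set a := g s - g (s - r) with ha
  set b := g (s + r) - g s with hb
  have hea : (1 - θ) * r ≤ inner ℝ e a := by
    have := H (s - r) s le_rfl (by linarith) (by linarith)
    rwa [sub_sub_cancel] at this
  have heb : (1 - θ) * r ≤ inner ℝ e b := by
    have := H s (s + r) (by linarith) (by linarith) (by linarith)
    rwa [add_sub_cancel_left] at this
  have hcs : ∀ v : E3, inner ℝ e v ≤ ‖v‖ := by
    intro v
    have := real_inner_le_norm e v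
    rwa [he, one_mul] at this
  have hab : 2 * (1 - θ) * r ≤ ‖a + b‖ := by
    have := hcs (a + b)
    rw [inner_add_right] at this
    linarith
  have har : ‖a‖ ≤ r := by
    have := hl s (s - r)
    rwa [sub_sub_cancel, abs_of_pos hr] at this
  have hbr : ‖b‖ ≤ r := by
    have := hl (s + r) s
    rwa [add_sub_cancel_left, abs_of_pos hr] at this
  have hpos : 0 < (1 - θ) * r := mul_pos (by linarith) hr
  have ha0 : 0 < ‖a‖ := hpos.trans_le (hea.trans (hcs a))
  have hb0 : 0 < ‖b‖ := hpos.trans_le (heb.trans (hcs b))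
  have hab0 : 0 < ‖a + b‖ := by linarith
  have eab : g (s + r) - g (s - r) = a + b := by rw [ha, hb]; abel
  have eya : g (s - r) - g s = -a := by rw [ha]; abel
  have n1 : g (s - r) ≠ g s := fun hc => by rw [ha, hc, sub_self, norm_zero] at ha0; linarith
  have n2 : g (s + r) ≠ g s := fun hc => by rw [hb, hc, sub_self, norm_zero] at hb0; linarith
  have n3 : g (s + r) ≠ g (s - r) := fun hc => by
    rw [← eab, hc, sub_self, norm_zero] at hab0; linarith
  have hk := hκ s (s - r) (s + r) n1 n2 n3
  have hks := kap_mul_sides (g s) (g (s - r)) (g (s + r)) n1 n2 n3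
  rw [eya, eab, ← hb, norm_neg] at hks
  have hcrn : ‖cr (-a) b‖ = ‖cr a b‖ := by
    rw [← neg_one_smul ℝ a, cr_smul_left, neg_one_smul, norm_neg]
  rw [hcrn] at hks
  have hcr : ‖cr a b‖ ≤ 2 * Real.pi * r ^ 3 := by
    have h1 : ‖a + b‖ ≤ 2 * r := (norm_add_le a b).trans (by linarith)
    have h2 : kap (g s) (g (s - r)) (g (s + r)) * (‖a‖ * ‖b‖ * ‖a + b‖) ≤
        2 * Real.pi * (r * r * (2 * r)) := by
      have := Real.pi_pos
      gcongr
    linarith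
  have := norm_sub_sq_le_of_cr hr hθ har hbr (hea.trans (hcs a)) (heb.trans (hcs b)) hab hcr
  rw [hθ2] at this
  linarith

end Flat

/-! ### Wirtinger's inequality on the Fourier side, without derivatives -/

theorem tendsto_two_sub_two_cos_div (x : ℝ) :
    Tendsto (fun h : ℝ => (2 - 2 * Real.cos (x * h)) / h ^ 2) (𝓝[>] 0) (𝓝 (x ^ 2)) := by
  have hd : HasDerivAt (fun h : ℝ => Real.sin (x / 2 * h)) (x / 2) 0 := by
    have h1 : HasDerivAt (fun h : ℝ => x / 2 * h) (x / 2) 0 := by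
      simpa using (hasDerivAt_id (0 : ℝ)).const_mul (x / 2)
    simpa using h1.sin
  have ht := hd.tendsto_slope_zero_right
  have h2 := (ht.pow 2).const_mul 4
  have h3 : 4 * (x / 2) ^ 2 = x ^ 2 := by ring
  rw [h3] at h2
  refine h2.congr' ?_
  filter_upwards [self_mem_nhdsWithin] with h hh
  have hh : h ≠ 0 := ne_of_gt hh
  have hc : Real.cos (x * h) = 1 - 2 * Real.sin (x / 2 * h) ^ 2 := by
    have : x * h = 2 * (x / 2 * h) := by ring
    rw [this, Real.cos_two_mul, Real.cos_sq']
    ring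
  rw [hc]
  simp
  field_simp
  ring

/-- The spectral form of the equality case in Wirtinger's inequality. -/
theorem eq_zero_of_spectral_bounds {w : ℤ → ℝ} (hw : ∀ n, 0 ≤ w n) {c l : ℝ → ℝ}
    (hc : Tendsto c (𝓝[>] 0) (𝓝 (4 * Real.pi ^ 2))) (hl : Tendsto l (𝓝[>] 0) (𝓝 1))
    (h2 : ∀ᶠ h in 𝓝[>] (0 : ℝ), ∃ S ≤ c h * h ^ 4,
      HasSum (fun n : ℤ => w n * (2 - 2 * Real.cos (2 * Real.pi * n * h)) ^ 2) S)
    (h1 : ∀ᶠ h in 𝓝[>] (0 : ℝ), ∃ S ≥ l h * h ^ 2,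
      HasSum (fun n : ℤ => w n * (2 - 2 * Real.cos (2 * Real.pi * n * h))) S)
    {n : ℤ} (hn : 2 ≤ |n|) : w n = 0 := by
  have hπ := Real.pi_pos
  -- Only finite partial sums are passed to the limit h → 0; this gives the fourth moment bound
  -- together with its summability.
  have hfin : ∀ s : Finset ℤ, ∑ n ∈ s, w n * ((2 * Real.pi * n) ^ 2) ^ 2 ≤ 4 * Real.pi ^ 2 := by
    intro s
    have ht : Tendsto (fun h : ℝ => ∑ n ∈ s,
        w n * ((2 - 2 * Real.cos (2 * Real.pi * n * h)) / h ^ 2) ^ 2) (𝓝[>] 0)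
        (𝓝 (∑ n ∈ s, w n * ((2 * Real.pi * n) ^ 2) ^ 2)) :=
      tendsto_finsetSum _ fun n _ => ((tendsto_two_sub_two_cos_div _).pow 2).const_mul _
    refine le_of_tendsto_of_tendsto ht hc ?_
    filter_upwards [h2, self_mem_nhdsWithin] with h ⟨S, hS, hsum⟩ hh
    have hh : 0 < h := hh
    have h3 : ∑ n ∈ s, w n * (2 - 2 * Real.cos (2 * Real.pi * n * h)) ^ 2 ≤ S :=
      sum_le_hasSum s (fun n _ => mul_nonneg (hw n) (sq_nonneg _)) hsum
    have h4 : ∑ n ∈ s, w n * ((2 - 2 * Real.cos (2 * Real.pi * n * h)) / h ^ 2) ^ 2 =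
        (∑ n ∈ s, w n * (2 - 2 * Real.cos (2 * Real.pi * n * h)) ^ 2) / h ^ 4 := by
      rw [Finset.sum_div]
      refine Finset.sum_congr rfl fun n _ => ?_
      field_simp
    rw [h4, div_le_iff₀ (by positivity)]
    exact h3.trans hS
  have hs4 : Summable fun n : ℤ => w n * ((2 * Real.pi * n) ^ 2) ^ 2 :=
    summable_of_sum_le (fun n => mul_nonneg (hw n) (by positivity)) hfin
  have h4le : ∑' n : ℤ, w n * ((2 * Real.pi * n) ^ 2) ^ 2 ≤ 4 * Real.pi ^ 2 :=
    hs4.tsum_le_of_sum_le hfin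
  have hone : ∀ n : ℤ, (2 * Real.pi * n) ^ 2 * (4 * Real.pi ^ 2) ≤ ((2 * Real.pi * n) ^ 2) ^ 2 := by
    intro n
    rcases eq_or_ne n 0 with rfl | h
    · simp
    · have h1 : (1 : ℝ) ≤ (n : ℝ) ^ 2 := by
        have : (1 : ℤ) ≤ n ^ 2 := by have := sq_nonneg n; have := pow_ne_zero 2 h; omega
        exact_mod_cast this
      have h2 : 4 * Real.pi ^ 2 ≤ (2 * Real.pi * n) ^ 2 := by nlinarith [sq_nonneg Real.pi]
      nlinarith [sq_nonneg (2 * Real.pi * n)]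
  have hs2 : Summable fun n : ℤ => w n * ((2 * Real.pi * n) ^ 2 * (4 * Real.pi ^ 2)) :=
    Summable.of_nonneg_of_le (fun n => mul_nonneg (hw n) (by positivity))
      (fun n => mul_le_mul_of_nonneg_left (hone n) (hw n)) hs4
  have hs2' : Summable fun n : ℤ => w n * (2 * Real.pi * n) ^ 2 := by
    have h5 : (fun n : ℤ => w n * (2 * Real.pi * n) ^ 2) =
        fun n : ℤ => w n * ((2 * Real.pi * n) ^ 2 * (4 * Real.pi ^ 2)) * (4 * Real.pi ^ 2)⁻¹ := by
      ext n
      field_simp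
    rw [h5]
    exact hs2.mul_right _
  -- Here no exchange of limits is needed, since 2 - 2 cos x ≤ x² bounds the sum termwise for every
  -- h.
  have h2le : 1 ≤ ∑' n : ℤ, w n * (2 * Real.pi * n) ^ 2 := by
    refine le_of_tendsto hl ?_
    filter_upwards [h1, self_mem_nhdsWithin] with h ⟨S, hS, hsum⟩ hh
    have hh : 0 < h := hh
    have h5 : S ≤ (∑' n : ℤ, w n * (2 * Real.pi * n) ^ 2) * h ^ 2 := by
      refine hasSum_le (fun n => ?_) hsum (hs2'.hasSum.mul_right (h ^ 2))
      rw [mul_assoc (w n)]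
      refine mul_le_mul_of_nonneg_left ?_ (hw n)
      have := Real.one_sub_sq_div_two_le_cos (x := 2 * Real.pi * n * h)
      linarith
    have h6 : 0 < h ^ 2 := by positivity
    exact le_of_mul_le_mul_right (hS.le.trans h5) h6
  have hdiff := hs4.sub hs2
  have hnn : ∀ n : ℤ, 0 ≤ w n * ((2 * Real.pi * n) ^ 2) ^ 2 -
      w n * ((2 * Real.pi * n) ^ 2 * (4 * Real.pi ^ 2)) := fun n =>
    sub_nonneg.2 (mul_le_mul_of_nonneg_left (hone n) (hw n))
  -- The two moments force the reverse of the termwise inequality, so every term of this nonnegative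
  -- series vanishes; the bracket is strictly positive for |n| ≥ 2.
  have htot : ∑' n : ℤ, (w n * ((2 * Real.pi * n) ^ 2) ^ 2 -
      w n * ((2 * Real.pi * n) ^ 2 * (4 * Real.pi ^ 2))) ≤ 0 := by
    rw [hs4.tsum_sub hs2]
    have : ∑' n : ℤ, w n * ((2 * Real.pi * n) ^ 2 * (4 * Real.pi ^ 2)) =
        (∑' n : ℤ, w n * (2 * Real.pi * n) ^ 2) * (4 * Real.pi ^ 2) := by
      rw [← tsum_mul_right]
      simp only [mul_assoc]
    rw [this]
    nlinarith [sq_nonneg Real.pi]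
  have hle := (hdiff.le_tsum n fun m _ => hnn m).trans htot
  have hn2 : (4 : ℝ) ≤ (n : ℝ) ^ 2 := by
    have : (4 : ℤ) ≤ n ^ 2 := by rw [← sq_abs]; nlinarith
    exact_mod_cast this
  have hgap : 0 < ((2 * Real.pi * n) ^ 2) ^ 2 - (2 * Real.pi * n) ^ 2 * (4 * Real.pi ^ 2) := by
    have : ((2 * Real.pi * n) ^ 2) ^ 2 - (2 * Real.pi * n) ^ 2 * (4 * Real.pi ^ 2) =
        16 * Real.pi ^ 4 * ((n : ℝ) ^ 2 * ((n : ℝ) ^ 2 - 1)) := by ring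
    rw [this]
    have : 0 < (n : ℝ) ^ 2 * ((n : ℝ) ^ 2 - 1) := mul_pos (by linarith) (by linarith)
    positivity
  rw [← mul_sub] at hle
  nlinarith [hw n]

/-! ### Parseval's identity for translates and differences -/

section Fourier

open AddCircle

theorem hasSum_sq_fourierCoeff_continuousMap (f : C(AddCircle (1 : ℝ), ℂ)) :
    HasSum (fun n => ‖fourierCoeff f n‖ ^ 2) (∫ t, ‖f t‖ ^ 2 ∂haarAddCircle) := by
  have h := hasSum_sq_fourierCoeff (ContinuousMap.toLp (E := ℂ) 2 haarAddCircle ℂ f)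
  simp_rw [fourierCoeff_toLp] at h
  have e : (fun t => ‖ContinuousMap.toLp (E := ℂ) 2 haarAddCircle ℂ f t‖ ^ 2) =ᵐ[haarAddCircle]
      fun t => ‖f t‖ ^ 2 := by
    filter_upwards [ContinuousMap.coeFn_toLp (p := 2) (𝕜 := ℂ) haarAddCircle f] with t ht
    rw [ht]
  rwa [integral_congr_ae e] at h

theorem fourierCoeff_continuousMap_sub (f₁ f₂ : C(AddCircle (1 : ℝ), ℂ)) (n : ℤ) :
    fourierCoeff (f₁ - f₂ : C(AddCircle (1 : ℝ), ℂ)) n = fourierCoeff f₁ n - fourierCoeff f₂ n := by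
  have hint : ∀ f : C(AddCircle (1 : ℝ), ℂ),
      Integrable (fun t => fourier (-n) t • f t) haarAddCircle := fun f =>
    (Continuous.smul (fourier (-n)).continuous f.continuous).integrable_of_hasCompactSupport
      (HasCompactSupport.of_compactSpace _)
  simp only [fourierCoeff]
  rw [← integral_sub (hint f₁) (hint f₂)]
  simp only [ContinuousMap.sub_apply, smul_sub]

/-- The translate of a function on the circle. -/
noncomputable def shiftMap (f : C(AddCircle (1 : ℝ), ℂ)) (c : AddCircle (1 : ℝ)) :
    C(AddCircle (1 : ℝ), ℂ) := f.comp ⟨fun t => t + c, by fun_prop⟩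

theorem shiftMap_apply (f : C(AddCircle (1 : ℝ), ℂ)) (c t : AddCircle (1 : ℝ)) :
    shiftMap f c t = f (t + c) := rfl

theorem fourier_add_apply (n : ℤ) (x y : AddCircle (1 : ℝ)) :
    fourier n (x + y) = fourier n x * fourier n y := by
  rw [fourier_apply, fourier_apply, fourier_apply, zsmul_add, toCircle_add, Circle.coe_mul]

theorem fourierCoeff_shiftMap (f : C(AddCircle (1 : ℝ), ℂ)) (c : AddCircle (1 : ℝ)) (n : ℤ) :
    fourierCoeff (shiftMap f c) n = fourier n c * fourierCoeff f n := by
  have h1 : fourier n c * fourier (-n) c = 1 := by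
    rw [← fourier_add, add_neg_cancel, fourier_zero]
  simp only [fourierCoeff, shiftMap_apply]
  rw [← integral_add_right_eq_self (fun t => fourier (-n) t • f t) c, ← integral_const_mul]
  congr 1
  ext t
  simp only [smul_eq_mul]
  rw [fourier_add_apply]
  linear_combination (-(fourier (-n) t * f (t + c))) * h1

theorem fourier_coe_eq (n : ℤ) (h : ℝ) :
    fourier n (h : AddCircle (1 : ℝ)) = Complex.exp (((2 * Real.pi * n * h : ℝ) : ℂ) * Complex.I) := by
  rw [fourier_coe_apply]
  congr 1
  push_cast
  rw [div_one]
  ring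

theorem normSq_fourier_sub_one (n : ℤ) (h : ℝ) :
    ‖fourier n (h : AddCircle (1 : ℝ)) - 1‖ ^ 2 = 2 - 2 * Real.cos (2 * Real.pi * n * h) := by
  rw [fourier_coe_eq, Complex.sq_norm, Complex.normSq_apply]
  simp only [Complex.sub_re, Complex.sub_im, Complex.exp_ofReal_mul_I_re,
    Complex.exp_ofReal_mul_I_im, Complex.one_re, Complex.one_im]
  linear_combination Real.sin_sq_add_cos_sq (2 * Real.pi * n * h)

theorem norm_sq_fourierCoeff_first_difference (f : C(AddCircle (1 : ℝ), ℂ)) (h : ℝ) (n : ℤ) :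
    ‖fourierCoeff (shiftMap f h - f : C(AddCircle (1 : ℝ), ℂ)) n‖ ^ 2 =
      ‖fourierCoeff f n‖ ^ 2 * (2 - 2 * Real.cos (2 * Real.pi * n * h)) := by
  rw [fourierCoeff_continuousMap_sub, fourierCoeff_shiftMap, ← sub_one_mul, norm_mul, mul_pow,
    normSq_fourier_sub_one, mul_comm]

/-- The multiplier u + v - 2, with u and v the characters at h and -h, factors as -(u - 1)(v - 1)
because uv = 1. -/
theorem norm_sq_fourierCoeff_second_difference (f : C(AddCircle (1 : ℝ), ℂ)) (h : ℝ) (n : ℤ) :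
    ‖fourierCoeff ((shiftMap f h - f) - (f - shiftMap f ((-h : ℝ) : AddCircle (1 : ℝ))) :
      C(AddCircle (1 : ℝ), ℂ)) n‖ ^ 2 =
      ‖fourierCoeff f n‖ ^ 2 * (2 - 2 * Real.cos (2 * Real.pi * n * h)) ^ 2 := by
  set u := fourier n (h : AddCircle (1 : ℝ)) with hu
  set v := fourier n ((-h : ℝ) : AddCircle (1 : ℝ)) with hv
  have huv : u * v = 1 := by
    rw [hu, hv, ← fourier_add_apply, ← AddCircle.coe_add, add_neg_cancel]
    simp
  have e : (u * fourierCoeff f n - fourierCoeff f n) - (fourierCoeff f n - v * fourierCoeff f n) =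
      -((u - 1) * (v - 1)) * fourierCoeff f n := by
    linear_combination fourierCoeff f n * huv
  have h1 : ‖u - 1‖ ^ 2 = _ := normSq_fourier_sub_one n h
  have h2 : ‖v - 1‖ ^ 2 = _ := normSq_fourier_sub_one n (-h)
  rw [mul_neg, Real.cos_neg] at h2
  rw [fourierCoeff_continuousMap_sub, fourierCoeff_continuousMap_sub,
    fourierCoeff_continuousMap_sub, fourierCoeff_shiftMap, fourierCoeff_shiftMap, e, norm_mul,
    norm_neg, norm_mul, mul_pow, mul_pow, h1, h2]
  ring

theorem exists_coordinate_maps {g : ℝ → E3} (hg : Continuous g) (hp : Function.Periodic g 1) :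
    ∃ f : Fin 3 → C(AddCircle (1 : ℝ), ℂ), ∀ i (t : ℝ), f i t = ((g t i : ℝ) : ℂ) := by
  refine ⟨fun i => ⟨fun x => ((hp.lift x i : ℝ) : ℂ), ?_⟩, fun i t => rfl⟩
  have h : Continuous (hp.lift : AddCircle (1 : ℝ) → E3) :=
    continuous_quot_lift _ hg
  fun_prop

theorem sum_integral_norm_sq_eq (F : Fin 3 → C(AddCircle (1 : ℝ), ℂ)) :
    ∑ i, ∫ t, ‖F i t‖ ^ 2 ∂haarAddCircle = ∫ t, ∑ i, ‖F i t‖ ^ 2 ∂haarAddCircle := by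
  rw [integral_finsetSum]
  intro i _
  exact Continuous.integrable_of_hasCompactSupport (by fun_prop) (HasCompactSupport.of_compactSpace _)

theorem sum_integral_le {F : Fin 3 → C(AddCircle (1 : ℝ), ℂ)} {V : ℝ → E3}
    (hF : ∀ i (t : ℝ), F i t = ((V t i : ℝ) : ℂ)) {C : ℝ} (hV : ∀ t, ‖V t‖ ^ 2 ≤ C) :
    ∑ i, ∫ t, ‖F i t‖ ^ 2 ∂haarAddCircle ≤ C := by
  rw [sum_integral_norm_sq_eq]
  have h : ∀ t, ∑ i, ‖F i t‖ ^ 2 ≤ C := by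
    intro t
    induction t using QuotientAddGroup.induction_on with
    | H t =>
      refine le_trans (le_of_eq ?_) (hV t)
      rw [E3.norm_sq, Fin.sum_univ_three]
      simp [hF]
  have hint : Integrable (fun t => ∑ i, ‖F i t‖ ^ 2) (haarAddCircle (T := 1)) :=
    Continuous.integrable_of_hasCompactSupport (by fun_prop) (HasCompactSupport.of_compactSpace _)
  calc _ ≤ ∫ _, C ∂(haarAddCircle (T := 1)) := integral_mono hint (integrable_const _) h
    _ = C := by simp

theorem le_sum_integral {F : Fin 3 → C(AddCircle (1 : ℝ), ℂ)} {V : ℝ → E3}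
    (hF : ∀ i (t : ℝ), F i t = ((V t i : ℝ) : ℂ)) {C : ℝ} (hV : ∀ t, C ≤ ‖V t‖ ^ 2) :
    C ≤ ∑ i, ∫ t, ‖F i t‖ ^ 2 ∂haarAddCircle := by
  rw [sum_integral_norm_sq_eq]
  have h : ∀ t, C ≤ ∑ i, ‖F i t‖ ^ 2 := by
    intro t
    induction t using QuotientAddGroup.induction_on with
    | H t =>
      refine le_trans (hV t) (le_of_eq ?_)
      rw [E3.norm_sq, Fin.sum_univ_three]
      simp [hF]
  have hint : Integrable (fun t => ∑ i, ‖F i t‖ ^ 2) (haarAddCircle (T := 1)) :=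
    Continuous.integrable_of_hasCompactSupport (by fun_prop) (HasCompactSupport.of_compactSpace _)
  calc C = ∫ _, C ∂(haarAddCircle (T := 1)) := by simp
    _ ≤ _ := integral_mono (integrable_const _) hint h

theorem eq_trig_of_fourierCoeff_eq_zero {f : C(AddCircle (1 : ℝ), ℂ)}
    (h : ∀ n : ℤ, 2 ≤ |n| → fourierCoeff f n = 0) :
    ∃ q a b : ℝ, ∀ t : ℝ, (f t).re =
      q + Real.cos (2 * Real.pi * t) * a + Real.sin (2 * Real.pi * t) * b := by
  have hzero : ∀ n ∉ ({-1, 0, 1} : Finset ℤ), fourierCoeff f n = 0 := by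
    intro n hn
    apply h
    simp only [Finset.mem_insert, Finset.mem_singleton, not_or] at hn
    rw [le_abs]
    omega
  have hsumm : Summable (fourierCoeff f) := summable_of_ne_finset_zero hzero
  refine ⟨(fourierCoeff f 0).re, (fourierCoeff f 1).re + (fourierCoeff f (-1)).re,
    (fourierCoeff f (-1)).im - (fourierCoeff f 1).im, fun t => ?_⟩
  have h1 := has_pointwise_sum_fourier_series_of_summable hsumm (t : AddCircle (1 : ℝ))
  have h2 : HasSum (fun n => fourierCoeff f n • fourier n (t : AddCircle (1 : ℝ)))
      (∑ n ∈ ({-1, 0, 1} : Finset ℤ), fourierCoeff f n • fourier n (t : AddCircle (1 : ℝ))) :=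
    hasSum_sum_of_ne_finset_zero fun n hn => by rw [hzero n hn, zero_smul]
  rw [h1.unique h2, Finset.sum_insert (by decide), Finset.sum_insert (by decide),
    Finset.sum_singleton]
  simp only [fourier_coe_eq, smul_eq_mul, Complex.add_re, Complex.mul_re,
    Complex.exp_ofReal_mul_I_re, Complex.exp_ofReal_mul_I_im]
  have e1 : 2 * Real.pi * ((-1 : ℤ) : ℝ) * t = -(2 * Real.pi * t) := by push_cast; ring
  have e2 : 2 * Real.pi * ((1 : ℤ) : ℝ) * t = 2 * Real.pi * t := by push_cast; ring
  have e3 : 2 * Real.pi * ((0 : ℤ) : ℝ) * t = 0 := by push_cast; ring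
  rw [e1, e2, e3, Real.cos_neg, Real.sin_neg, Real.cos_zero, Real.sin_zero]
  ring

end Fourier

/-! ### The limit curve is a round circle -/

section Rigidity

variable {g : ℝ → E3} {K D₀ : ℝ}

theorem tendsto_mul_rpow_zero (K c : ℝ) :
    Tendsto (fun r : ℝ => K * (c * r) ^ (3 / 2 : ℝ)) (𝓝[>] 0) (𝓝 0) := by
  have h : Continuous fun r : ℝ => K * (c * r) ^ (3 / 2 : ℝ) :=
    continuous_const.mul ((continuous_const.mul continuous_id).rpow_const fun _ =>
      Or.inr (by norm_num))
  have := h.tendsto 0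
  rw [mul_zero, Real.zero_rpow (by norm_num), mul_zero] at this
  exact this.mono_left nhdsWithin_le_nhds

/-- The spectral weights are the squared Fourier coefficients summed over the three coordinates:
only the total satisfies the two bounds, and its vanishing kills each coordinate separately. -/
theorem IsFlat.eq_trig (h : IsFlat K D₀ g) (hK : 0 ≤ K) (hD₀ : 0 < D₀)
    (hl : ∀ s t, ‖g s - g t‖ ≤ |s - t|) (hp : Function.Periodic g 1) (hκ : KapLeTwoPi g) :
    ∃ q a b : E3, ∀ t, g t = q + Real.cos (2 * Real.pi * t) • a + Real.sin (2 * Real.pi * t) • b := by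
  have hgc : Continuous g := by
    have : LipschitzWith 1 g := LipschitzWith.of_dist_le_mul fun s t => by
      simpa [dist_eq_norm] using hl s t
    exact this.continuous
  obtain ⟨f, hf⟩ := exists_coordinate_maps hgc hp
  set w : ℤ → ℝ := fun n => ∑ i, ‖fourierCoeff (f i) n‖ ^ 2 with hw
  have hsmall : ∀ᶠ r in 𝓝[>] (0 : ℝ), 2 * r ≤ D₀ ∧ K * (2 * r) ^ (3 / 2 : ℝ) < 1 / 4 ∧
      K * (1 * r) ^ (3 / 2 : ℝ) < 1 / 4 := by
    have h1 : ∀ᶠ r in 𝓝[>] (0 : ℝ), r < D₀ / 2 :=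
      nhdsWithin_le_nhds (Iio_mem_nhds (by positivity))
    have h4 : Iio (1 / 4 : ℝ) ∈ 𝓝 (0 : ℝ) := Iio_mem_nhds (by norm_num)
    filter_upwards [h1, (tendsto_mul_rpow_zero K 2).eventually h4,
      (tendsto_mul_rpow_zero K 1).eventually h4] with r h1 h2 h3
    exact ⟨by linarith, h2, h3⟩
  have hzero : ∀ n : ℤ, 2 ≤ |n| → w n = 0 := by
    intro n hn
    refine eq_zero_of_spectral_bounds (w := w) (fun n => by positivity)
      (c := fun r => 8 * K ^ 2 * r + 4 * Real.pi ^ 2 / (1 - 4 * (K * (2 * r) ^ (3 / 2 : ℝ))))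
      (l := fun r => (1 - K * (1 * r) ^ (3 / 2 : ℝ)) ^ 2) ?_ ?_ ?_ ?_ hn
    · have h1 : Tendsto (fun r : ℝ => 8 * K ^ 2 * r) (𝓝[>] 0) (𝓝 (8 * K ^ 2 * 0)) :=
        (tendsto_id.const_mul _).mono_left nhdsWithin_le_nhds
      have h2 := (((tendsto_mul_rpow_zero K 2).const_mul 4).const_sub 1)
      have h3 := h1.add ((tendsto_const_nhds (x := 4 * Real.pi ^ 2)).div h2 (by norm_num))
      simpa using h3
    · have := ((tendsto_mul_rpow_zero K 1).const_sub 1).pow 2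
      simpa using this
    · filter_upwards [hsmall, self_mem_nhdsWithin] with r ⟨hr1, hr2, _⟩ hr
      refine ⟨_, sum_integral_le (F := fun i => (shiftMap (f i) r - f i) -
        (f i - shiftMap (f i) ((-r : ℝ) : AddCircle (1 : ℝ))))
        (V := fun s => (g (s + r) - g s) - (g s - g (s - r))) (fun i t => ?_)
        (h.second_difference_le hK hl hκ hr hr1 (by linarith)), ?_⟩
      · simp only [ContinuousMap.sub_apply, shiftMap_apply, ← AddCircle.coe_add, hf,
          PiLp.sub_apply, sub_eq_add_neg t r]
        push_cast
        ring
      · have := hasSum_sum (s := Finset.univ) fun (i : Fin 3) _ =>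
          hasSum_sq_fourierCoeff_continuousMap ((shiftMap (f i) r - f i) -
            (f i - shiftMap (f i) ((-r : ℝ) : AddCircle (1 : ℝ))))
        simp only [norm_sq_fourierCoeff_second_difference, ← Finset.sum_mul] at this
        exact this
    · filter_upwards [hsmall, self_mem_nhdsWithin] with r ⟨hr1, _, hr2⟩ hr
      have hr : 0 < r := hr
      refine ⟨_, le_sum_integral (F := fun i => shiftMap (f i) r - f i)
        (V := fun s => g (s + r) - g s) (fun i t => ?_) (fun s => ?_), ?_⟩
      · simp only [ContinuousMap.sub_apply, shiftMap_apply, ← AddCircle.coe_add, hf,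
          PiLp.sub_apply]
        push_cast
        ring
      · rw [← mul_pow]
        rw [one_mul] at hr2 ⊢
        exact pow_le_pow_left₀ (mul_nonneg (by linarith) hr.le)
          (h.le_norm_sub hr (by linarith)) 2
      · have := hasSum_sum (s := Finset.univ) fun (i : Fin 3) _ =>
          hasSum_sq_fourierCoeff_continuousMap (shiftMap (f i) r - f i)
        simp only [norm_sq_fourierCoeff_first_difference, ← Finset.sum_mul] at this
        exact this
  have hcoef : ∀ i, ∀ n : ℤ, 2 ≤ |n| → fourierCoeff (f i) n = 0 := by
    intro i n hn
    have := (Finset.sum_eq_zero_iff_of_nonneg fun i _ => by positivity).1 (hzero n hn) i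
      (Finset.mem_univ i)
    simpa using this
  choose q a b hqab using fun i => eq_trig_of_fourierCoeff_eq_zero (hcoef i)
  refine ⟨WithLp.toLp 2 q, WithLp.toLp 2 a, WithLp.toLp 2 b, fun t => ?_⟩
  ext i
  have := hqab i t
  rw [hf, Complex.ofReal_re] at this
  simpa using this

theorem IsFlat.norm_deriv_eq_one (h : IsFlat K D₀ g) (hD₀ : 0 < D₀)
    (hl : ∀ s t, ‖g s - g t‖ ≤ |s - t|) {t : ℝ} {v : E3} (hv : HasDerivAt g v t) : ‖v‖ = 1 := by
  have h1 := hv.tendsto_slope_zero_right.norm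
  have h2 : Tendsto (fun r : ℝ => 1 - K * (1 * r) ^ (3 / 2 : ℝ)) (𝓝[>] 0) (𝓝 1) := by
    simpa using (tendsto_mul_rpow_zero K 1).const_sub 1
  have hD : ∀ᶠ r in 𝓝[>] (0 : ℝ), r < D₀ := nhdsWithin_le_nhds (Iio_mem_nhds hD₀)
  apply le_antisymm
  · refine le_of_tendsto h1 ?_
    filter_upwards [self_mem_nhdsWithin] with r hr
    have hr : 0 < r := hr
    have := hl (t + r) t
    rw [add_sub_cancel_left, abs_of_pos hr] at this
    rwa [norm_smul, norm_inv, Real.norm_of_nonneg hr.le, inv_mul_le_iff₀ hr, mul_one]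
  · refine le_of_tendsto_of_tendsto h2 h1 ?_
    filter_upwards [self_mem_nhdsWithin, hD] with r hr hrD
    have hr : 0 < r := hr
    have := h.le_norm_sub (s := t) hr hrD.le
    rw [norm_smul, norm_inv, Real.norm_of_nonneg hr.le, le_inv_mul_iff₀ hr, one_mul]
    linarith

/-- A closed curve of length one whose Menger curvature is at most `2π` is a round circle. -/
theorem IsFlat.eq_circle (h : IsFlat K D₀ g) (hK : 0 ≤ K) (hD₀ : 0 < D₀)
    (hl : ∀ s t, ‖g s - g t‖ ≤ |s - t|) (hp : Function.Periodic g 1) (hκ : KapLeTwoPi g) :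
    ∃ q a b : E3, ‖a‖ = (2 * Real.pi)⁻¹ ∧ ‖b‖ = (2 * Real.pi)⁻¹ ∧ inner ℝ a b = 0 ∧
      ∀ t, g t = q + Real.cos (2 * Real.pi * t) • a + Real.sin (2 * Real.pi * t) • b := by
  have hπ := Real.pi_pos
  obtain ⟨q, a, b, hg⟩ := h.eq_trig hK hD₀ hl hp hκ
  have hd : ∀ t, ‖(2 * Real.pi) • (Real.cos (2 * Real.pi * t) • b -
      Real.sin (2 * Real.pi * t) • a)‖ = 1 := by
    intro t
    have hc : HasDerivAt (fun t : ℝ => 2 * Real.pi * t) (2 * Real.pi) t := by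
      simpa using (hasDerivAt_id t).const_mul (2 * Real.pi)
    have h1 := ((hc.cos.smul_const a).const_add q).add (hc.sin.smul_const b)
    have h2 : HasDerivAt g ((2 * Real.pi) • (Real.cos (2 * Real.pi * t) • b -
      Real.sin (2 * Real.pi * t) • a)) t := by
      have e : g = fun t => q + Real.cos (2 * Real.pi * t) • a +
        Real.sin (2 * Real.pi * t) • b := funext hg
      rw [e]
      convert! h1 using 1
      module
    exact h.norm_deriv_eq_one hD₀ hl h2
  have hn : ∀ v : E3, ‖(2 * Real.pi) • v‖ = 1 → ‖v‖ = (2 * Real.pi)⁻¹ := by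
    intro v hv
    rw [norm_smul, Real.norm_of_nonneg (by positivity)] at hv
    exact eq_inv_of_mul_eq_one_right hv
  have hb : ‖b‖ = (2 * Real.pi)⁻¹ := hn b (by simpa using hd 0)
  have ha : ‖a‖ = (2 * Real.pi)⁻¹ := by
    -- Unit speed at the times 0, 1/4 and 1/8 yields the norm of b, the norm of a, and their
    -- orthogonality.
    have := hd (1 / 4)
    have e : 2 * Real.pi * (1 / 4) = Real.pi / 2 := by ring
    rw [e, Real.cos_pi_div_two, Real.sin_pi_div_two, zero_smul, one_smul, zero_sub, smul_neg,
      norm_neg] at this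
    exact hn a this
  refine ⟨q, a, b, ha, hb, ?_, hg⟩
  have h1 := hn _ (hd (1 / 8))
  have e : 2 * Real.pi * (1 / 8) = Real.pi / 4 := by ring
  rw [e, Real.cos_pi_div_four, Real.sin_pi_div_four, ← smul_sub, norm_smul,
    Real.norm_of_nonneg (by positivity)] at h1
  have h2 : (√2 / 2 * ‖b - a‖) ^ 2 = ((2 * Real.pi)⁻¹) ^ 2 := by rw [h1]
  rw [mul_pow, norm_sub_sq_real, ha, hb, div_pow, Real.sq_sqrt zero_le_two, real_inner_comm] at h2
  linarith

end Rigidity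

/-! ### Compactness -/

theorem tendsto_kap {ι : Type*} {l : Filter ι} {x y z : ι → E3} {x₀ y₀ z₀ : E3}
    (hx : Tendsto x l (𝓝 x₀)) (hy : Tendsto y l (𝓝 y₀)) (hz : Tendsto z l (𝓝 z₀))
    (h1 : y₀ ≠ x₀) (h2 : z₀ ≠ x₀) (h3 : z₀ ≠ y₀) :
    Tendsto (fun i => kap (x i) (y i) (z i)) l (𝓝 (kap x₀ y₀ z₀)) := by
  have p1 := norm_pos_iff.2 (sub_ne_zero.2 h1)
  have p2 := norm_pos_iff.2 (sub_ne_zero.2 h2)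
  have p3 := norm_pos_iff.2 (sub_ne_zero.2 h3)
  have t1 := hy.sub hx
  have t2 := hz.sub hx
  have t3 := hz.sub hy
  have tc := ((continuous_cr.tendsto (y₀ - x₀, z₀ - x₀)).comp (t1.prodMk_nhds t2)).norm
  unfold kap
  exact (tc.const_mul 2).div ((t1.norm.mul t2.norm).mul t3.norm) (by positivity)

/-! ### Properties passing to pointwise ultrafilter limits -/

section Limit

variable {U : Ultrafilter ℕ} {g : ℕ → ℝ → E3} {G : ℝ → E3}

theorem lip_of_tendsto (hlim : ∀ t, Tendsto (fun n => g n t) U (𝓝 (G t)))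
    (hl : ∀ n s t, ‖g n s - g n t‖ ≤ |s - t|) (s t : ℝ) : ‖G s - G t‖ ≤ |s - t| :=
  le_of_tendsto ((hlim s).sub (hlim t)).norm (Eventually.of_forall fun n => hl n s t)

theorem periodic_of_tendsto (hlim : ∀ t, Tendsto (fun n => g n t) U (𝓝 (G t)))
    (hp : ∀ n, Function.Periodic (g n) 1) : Function.Periodic G 1 := fun t => by
  refine tendsto_nhds_unique (hlim (t + 1)) ?_
  simpa only [hp _ t] using hlim t

/-- For each window the directions converge along the ultrafilter by compactness of the sphere. This
replaces control of the length of the limit, which is never established directly. -/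
theorem isFlat_of_tendsto (hlim : ∀ t, Tendsto (fun n => g n t) U (𝓝 (G t))) {K D₀ : ℝ}
    (hf : ∀ n, IsFlat K D₀ (g n)) : IsFlat K D₀ G := by
  intro a D hD hDD
  choose e he H using fun n => hf n a D hD hDD
  obtain ⟨e₀, he₀, hle⟩ := (isCompact_sphere (0 : E3) 1).ultrafilter_le_nhds (U.map e) (by
    rw [le_principal_iff]
    exact mem_map.2 (univ_mem' fun n => by simp [he n]))
  have hle : Tendsto e U (𝓝 e₀) := hle
  refine ⟨e₀, by simpa using he₀, fun s t h1 h2 h3 => ?_⟩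
  exact ge_of_tendsto (hle.inner ((hlim t).sub (hlim s)))
    (Eventually.of_forall fun n => H n s t h1 h2 h3)

theorem kapLeTwoPi_of_tendsto (hlim : ∀ t, Tendsto (fun n => g n t) U (𝓝 (G t)))
    (hκ : ∀ ε > 0, ∀ d > 0, ∀ᶠ n in (U : Filter ℕ), ∀ s t u, d ≤ ‖g n t - g n s‖ →
      d ≤ ‖g n u - g n s‖ → d ≤ ‖g n u - g n t‖ →
      kap (g n s) (g n t) (g n u) ≤ 2 * Real.pi * (1 + ε)) : KapLeTwoPi G := by
  intro s t u h1 h2 h3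
  have p1 := norm_pos_iff.2 (sub_ne_zero.2 h1)
  have p2 := norm_pos_iff.2 (sub_ne_zero.2 h2)
  have p3 := norm_pos_iff.2 (sub_ne_zero.2 h3)
  have t1 := ((hlim t).sub (hlim s)).norm
  have t2 := ((hlim u).sub (hlim s)).norm
  have t3 := ((hlim u).sub (hlim t)).norm
  have tk := tendsto_kap (hlim s) (hlim t) (hlim u) h1 h2 h3
  have hε : ∀ ε > 0, kap (G s) (G t) (G u) ≤ 2 * Real.pi * (1 + ε) := by
    intro ε hε
    set d := min (min ‖G t - G s‖ ‖G u - G s‖) ‖G u - G t‖ / 2 with hd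
    have hm : 0 < min (min ‖G t - G s‖ ‖G u - G s‖) ‖G u - G t‖ := lt_min (lt_min p1 p2) p3
    have hd0 : 0 < d := by positivity
    have d1 : d < ‖G t - G s‖ := by
      have := (min_le_left (min ‖G t - G s‖ ‖G u - G s‖) ‖G u - G t‖).trans (min_le_left _ _)
      linarith
    have d2 : d < ‖G u - G s‖ := by
      have := (min_le_left (min ‖G t - G s‖ ‖G u - G s‖) ‖G u - G t‖).trans (min_le_right _ _)
      linarith
    have d3 : d < ‖G u - G t‖ := by
      have := min_le_right (min ‖G t - G s‖ ‖G u - G s‖) ‖G u - G t‖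
      linarith
    refine le_of_tendsto tk ?_
    filter_upwards [hκ ε hε d hd0, t1.eventually_const_lt d1,
      t2.eventually_const_lt d2, t3.eventually_const_lt d3] with n hn e1 e2 e3
    exact hn s t u e1.le e2.le e3.le
  have hlimε : Tendsto (fun ε : ℝ => 2 * Real.pi * (1 + ε)) (𝓝[>] 0) (𝓝 (2 * Real.pi * (1 + 0))) :=
    ((tendsto_id.const_add 1).const_mul _).mono_left nhdsWithin_le_nhds
  rw [add_zero, mul_one] at hlimε
  exact ge_of_tendsto hlimε (eventually_of_mem self_mem_nhdsWithin fun ε h => hε ε h)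

theorem periodic_fract {f : ℝ → E3} (hf : Function.Periodic f 1) (t : ℝ) :
    f (Int.fract t) = f t := by
  have := hf.sub_zsmul_eq ⌊t⌋ (x := t)
  rwa [zsmul_eq_mul, mul_one] at this

/-- Periodicity and the common Lipschitz constant reduce uniform convergence to a finite grid of one
period. -/
theorem uniform_of_tendsto (hlim : ∀ t, Tendsto (fun n => g n t) U (𝓝 (G t)))
    (hl : ∀ n s t, ‖g n s - g n t‖ ≤ |s - t|) (hp : ∀ n, Function.Periodic (g n) 1)
    {μ : ℝ} (hμ : 0 < μ) : ∀ᶠ n in (U : Filter ℕ), ∀ t, ‖g n t - G t‖ ≤ μ := by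
  have hlG := lip_of_tendsto hlim hl
  have hpG := periodic_of_tendsto hlim hp
  obtain ⟨N, hN⟩ := exists_nat_one_div_lt (show 0 < μ / 3 by positivity)
  set M : ℝ := (N : ℝ) + 1 with hM
  have hM0 : 0 < M := by positivity
  have hgrid : ∀ᶠ n in (U : Filter ℕ), ∀ j ∈ Finset.range (N + 1),
      ‖g n (j / M) - G (j / M)‖ < μ / 3 := by
    rw [eventually_all_finset]
    intro j _
    have := ((hlim (j / M)).sub_const (G (j / M))).norm
    rw [sub_self, norm_zero] at this
    exact this.eventually (Iio_mem_nhds (by positivity))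
  filter_upwards [hgrid] with n hn t
  rw [← periodic_fract (hp n) t, ← periodic_fract hpG t]
  set x := Int.fract t
  have hx0 : 0 ≤ x := Int.fract_nonneg t
  have hx1 : x < 1 := Int.fract_lt_one t
  set j := ⌊M * x⌋₊ with hj
  have hj1 : (j : ℝ) ≤ M * x := Nat.floor_le (by positivity)
  have hj2 : M * x < j + 1 := Nat.lt_floor_add_one _
  have hjN : j ∈ Finset.range (N + 1) := by
    rw [Finset.mem_range]
    have : (j : ℝ) < N + 1 := by nlinarith
    exact_mod_cast this
  have hdist : |x - j / M| ≤ μ / 3 := by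
    have e : x - j / M = (M * x - j) / M := by field_simp
    rw [e, abs_of_nonneg (div_nonneg (by linarith) hM0.le)]
    refine le_trans ?_ hN.le
    gcongr
    linarith
  have h1 := (hl n x (j / M)).trans hdist
  have h2 := (hlG x (j / M)).trans hdist
  have h3 := (hn j hjN).le
  have e : g n x - G x = (g n x - g n (j / M)) + (g n (j / M) - G (j / M)) - (G x - G (j / M)) := by
    abel
  rw [e]
  have h4 := norm_sub_le ((g n x - g n (j / M)) + (g n (j / M) - G (j / M))) (G x - G (j / M))
  have h5 := norm_add_le (g n x - g n (j / M)) (g n (j / M) - G (j / M))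
  linarith

end Limit

theorem exists_ultrafilter_limit {g : ℕ → ℝ → E3} (hb : ∀ n t, ‖g n t‖ ≤ 1) :
    ∃ (U : Ultrafilter ℕ) (G : ℝ → E3), (U : Filter ℕ) ≤ atTop ∧
      ∀ t, Tendsto (fun n => g n t) U (𝓝 (G t)) := by
  have h : ∀ t, ∃ x, Tendsto (fun n => g n t) (hyperfilter ℕ : Filter ℕ) (𝓝 x) := by
    intro t
    obtain ⟨x, _, hx⟩ := (isCompact_closedBall (0 : E3) 1).ultrafilter_le_nhds
      ((hyperfilter ℕ).map fun n => g n t) (by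
        rw [le_principal_iff]
        exact mem_map.2 (univ_mem' fun n => by simp [hb n t]))
    exact ⟨x, hx⟩
  choose G hG using h
  exact ⟨hyperfilter ℕ, G, Nat.hyperfilter_le_atTop, hG⟩

/-! ### Loops close to the circle are unknotted -/

theorem norm_sub_smul_le_of_inner {v e : E3} {r θ σ : ℝ} (hr : 0 ≤ r) (he : ‖e‖ = 1)
    (hv : ‖v‖ ≤ r) (h : (1 - θ) * r ≤ inner ℝ e v) (hσ : 0 ≤ σ) (hθσ : 2 * θ ≤ σ ^ 2) :
    ‖v - r • e‖ ≤ σ * r := by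
  apply le_of_sq_le_sq _ (by positivity)
  rw [norm_sub_sq_real, norm_smul, he, real_inner_smul_right, real_inner_comm,
    Real.norm_of_nonneg hr, mul_pow]
  have h1 : ‖v‖ ^ 2 ≤ r ^ 2 := pow_le_pow_left₀ (norm_nonneg _) hv 2
  have h2 := mul_le_mul_of_nonneg_left h hr
  have h3 := mul_le_mul_of_nonneg_right hθσ (sq_nonneg r)
  linarith

theorem lipschitz_of_local {E : Type*} [NormedAddCommGroup E] {f : ℝ → E} {D c : ℝ} (hD : 0 < D)
    (h : ∀ s t, s ≤ t → t ≤ s + D → ‖f t - f s‖ ≤ c * (t - s)) (s t : ℝ) :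
    ‖f t - f s‖ ≤ c * |t - s| := by
  have key : ∀ n : ℕ, ∀ s t, s ≤ t → t ≤ s + n * D → ‖f t - f s‖ ≤ c * (t - s) := by
    intro n
    induction n with
    | zero =>
      intro s t h1 h2
      have : t = s := by simp at h2; linarith
      simp [this]
    | succ n ih =>
      intro s t h1 h2
      rcases le_total t (s + D) with h3 | h3
      · exact h s t h1 h3
      · have e1 := h s (s + D) (by linarith) le_rfl
        have e2 := ih (s + D) t h3 (by push_cast at h2; linarith)
        have e3 := norm_add_le (f t - f (s + D)) (f (s + D) - f s)
        rw [sub_add_sub_cancel] at e3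
        linarith
  have key' : ∀ s t, s ≤ t → ‖f t - f s‖ ≤ c * (t - s) := by
    intro s t hst
    obtain ⟨n, hn⟩ := exists_nat_ge ((t - s) / D)
    rw [div_le_iff₀ hD] at hn
    exact key n s t hst (by linarith)
  rcases le_total s t with hst | hst
  · rw [abs_of_nonneg (by linarith)]; exact key' s t hst
  · rw [norm_sub_rev, abs_sub_comm, abs_of_nonneg (by linarith)]; exact key' t s hst

/-- On a window of length D each curve is a straight motion up to relative error σ. Comparing the
endpoints of the window shows the two directions differ by at most 2σ + 2μ/D, so the increments of g
- G are small at every smaller scale as well. -/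
theorem IsFlat.lipschitz_sub {g G : ℝ → E3} {K D₀ D σ μ : ℝ} (hg : IsFlat K D₀ g)
    (hG : IsFlat K D₀ G) (hlg : ∀ s t, ‖g s - g t‖ ≤ |s - t|) (hlG : ∀ s t, ‖G s - G t‖ ≤ |s - t|)
    (hD : 0 < D) (hDD : D ≤ D₀) (hσ : 0 ≤ σ) (hKσ : 2 * (K * D ^ (3 / 2 : ℝ)) ≤ σ ^ 2)
    (hμ : ∀ t, ‖g t - G t‖ ≤ μ) (s t : ℝ) :
    ‖(g t - G t) - (g s - G s)‖ ≤ (4 * σ + 2 * (μ / D)) * |t - s| := by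
  refine lipschitz_of_local (f := fun t => g t - G t) hD (fun s t hst htD => ?_) s t
  obtain ⟨e, he, H⟩ := hg s D hD hDD
  obtain ⟨e', he', H'⟩ := hG s D hD hDD
  have hlg' : ∀ r, s ≤ r → ‖g r - g s‖ ≤ r - s := fun r hr => by
    have := hlg r s; rwa [abs_of_nonneg (by linarith)] at this
  have hlG' : ∀ r, s ≤ r → ‖G r - G s‖ ≤ r - s := fun r hr => by
    have := hlG r s; rwa [abs_of_nonneg (by linarith)] at this
  have b1 : ∀ r, s ≤ r → r ≤ s + D → ‖(g r - g s) - (r - s) • e‖ ≤ σ * (r - s) := fun r h1 h2 =>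
    norm_sub_smul_le_of_inner (by linarith) he (hlg' r h1) (H s r le_rfl h1 h2) hσ hKσ
  have b2 : ∀ r, s ≤ r → r ≤ s + D → ‖(G r - G s) - (r - s) • e'‖ ≤ σ * (r - s) := fun r h1 h2 =>
    norm_sub_smul_le_of_inner (by linarith) he' (hlG' r h1) (H' s r le_rfl h1 h2) hσ hKσ
  have hee : D * ‖e - e'‖ ≤ 2 * σ * D + 2 * μ := by
    have c1 := b1 (s + D) (by linarith) le_rfl
    have c2 := b2 (s + D) (by linarith) le_rfl
    rw [add_sub_cancel_left] at c1 c2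
    have e1 : D • (e - e') = ((G (s + D) - G s) - D • e') - ((g (s + D) - g s) - D • e) +
        ((g (s + D) - G (s + D)) - (g s - G s)) := by module
    have e2 : D * ‖e - e'‖ = ‖D • (e - e')‖ := by rw [norm_smul, Real.norm_of_nonneg hD.le]
    rw [e2, e1]
    have c3 := norm_add_le (((G (s + D) - G s) - D • e') - ((g (s + D) - g s) - D • e))
      ((g (s + D) - G (s + D)) - (g s - G s))
    have c4 := norm_sub_le ((G (s + D) - G s) - D • e') ((g (s + D) - g s) - D • e)
    have c5 := norm_sub_le (g (s + D) - G (s + D)) (g s - G s)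
    have c6 := hμ (s + D)
    have c7 := hμ s
    linarith
  have hee' : ‖e - e'‖ ≤ 2 * σ + 2 * (μ / D) := by
    have : D * (2 * σ + 2 * (μ / D)) = 2 * σ * D + 2 * μ := by field_simp
    rw [← this] at hee
    exact le_of_mul_le_mul_left hee hD
  have e1 : (g t - G t) - (g s - G s) = ((g t - g s) - (t - s) • e) -
      ((G t - G s) - (t - s) • e') + (t - s) • (e - e') := by module
  have c1 := b1 t hst htD
  have c2 := b2 t hst htD
  have c3 := norm_add_le (((g t - g s) - (t - s) • e) - ((G t - G s) - (t - s) • e'))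
    ((t - s) • (e - e'))
  have c4 := norm_sub_le ((g t - g s) - (t - s) • e) ((G t - G s) - (t - s) • e')
  rw [norm_smul, Real.norm_of_nonneg (show 0 ≤ t - s by linarith)] at c3
  have c5 := mul_le_mul_of_nonneg_left hee' (show 0 ≤ t - s by linarith)
  change ‖(g t - G t) - (g s - G s)‖ ≤ _
  rw [e1]
  linarith

/-- Chord-arc estimate on the circle, modulo the period: with x the distance to the nearest integer,
the chord is sin(πx)/π ≥ 2x/π ≥ x/2 by Jordan's inequality. -/
theorem exists_int_abs_sub_le {q a b : E3} (ha : ‖a‖ = (2 * Real.pi)⁻¹) (hb : ‖b‖ = (2 * Real.pi)⁻¹)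
    (hab : inner ℝ a b = 0) {G : ℝ → E3}
    (hG : ∀ t, G t = q + Real.cos (2 * Real.pi * t) • a + Real.sin (2 * Real.pi * t) • b)
    (s t : ℝ) : ∃ k : ℤ, |t - s - k| ≤ 2 * ‖G t - G s‖ := by
  have hπ := Real.pi_pos
  refine ⟨round (t - s), ?_⟩
  set x := t - s - round (t - s) with hx
  have hx2 : |x| ≤ 1 / 2 := abs_sub_round _
  have h1 : ‖G t - G s‖ = 2 * (2 * Real.pi)⁻¹ * |Real.sin (Real.pi * x)| := by
    have e : G t - G s = (Real.cos (2 * Real.pi * t) • a + Real.sin (2 * Real.pi * t) • b) -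
        (Real.cos (2 * Real.pi * s) • a + Real.sin (2 * Real.pi * s) • b) := by
      rw [hG, hG]; abel
    have e2 : (2 * Real.pi * t - 2 * Real.pi * s) / 2 =
        Real.pi * x + (round (t - s) : ℤ) * Real.pi := by rw [hx]; ring
    rw [e, norm_circle_sub ha hb hab, e2, Real.sin_add_int_mul_pi, abs_mul]
    simp
  have h2 : 2 * |x| ≤ |Real.sin (Real.pi * x)| := by
    have h3 : ∀ y : ℝ, 0 ≤ y → y ≤ 1 / 2 → 2 * y ≤ Real.sin (Real.pi * y) := by
      intro y h0 h1
      have := Real.mul_le_sin (x := Real.pi * y) (by positivity) (by nlinarith)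
      have e : 2 / Real.pi * (Real.pi * y) = 2 * y := by field_simp
      rwa [e] at this
    have h4 := h3 |x| (abs_nonneg x) hx2
    rcases abs_choice x with h | h
    · rw [h] at h4 ⊢
      exact h4.trans (le_abs_self _)
    · rw [h, mul_neg Real.pi, Real.sin_neg] at h4
      rw [h]
      exact h4.trans (neg_le_abs _)
  have h5 : 2 * (2 * Real.pi)⁻¹ * (2 * |x|) ≤ ‖G t - G s‖ := by rw [h1]; gcongr
  have h6 : 1 / 2 ≤ 2 * (2 * Real.pi)⁻¹ * 2 := by
    have : 2 * (2 * Real.pi)⁻¹ * 2 = 2 / Real.pi := by field_simp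
    rw [this, le_div_iff₀ hπ]
    linarith [Real.pi_lt_four]
  have h7 := mul_le_mul_of_nonneg_right h6 (abs_nonneg x)
  linarith

/-- The chord-arc estimate turns the parameter bound on g - G into a Lipschitz bound 2c with respect
to points of the circle. A value below 1 excludes double points; a value below the reciprocal of the
extension constant allows an ambient isotopy. -/
theorem isUnknot_of_close {γ : ℝ → E3} (hγ : IsUnitLoop γ) {q a b : E3}
    (ha : ‖a‖ = (2 * Real.pi)⁻¹) (hb : ‖b‖ = (2 * Real.pi)⁻¹) (hab : inner ℝ a b = 0) {G : ℝ → E3}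
    (hG : ∀ t, G t = q + Real.cos (2 * Real.pi * t) • a + Real.sin (2 * Real.pi * t) • b)
    {c : NNReal} (hc : 2 * c < 1) (hc' : lipschitzExtensionConstant E3 * (2 * c) < 1)
    (h : ∀ s t, ‖(perExt γ t - G t) - (perExt γ s - G s)‖ ≤ c * |t - s|) : IsUnknot γ := by
  have hπ := Real.pi_pos
  set g := perExt γ with hg
  have hloop : IsLoop g := hγ.isLoop_perExt
  have hGper : Function.Periodic G 1 := by
    intro t
    have : 2 * Real.pi * (t + 1) = 2 * Real.pi * t + 2 * Real.pi := by ring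
    simp only [hG, this, Real.cos_add_two_pi, Real.sin_add_two_pi]
  have hshift : ∀ {f : ℝ → E3}, Function.Periodic f 1 → ∀ (k : ℤ) t, f (t - k) = f t := by
    intro f hf k t
    have := hf.sub_zsmul_eq k (x := t)
    rwa [zsmul_eq_mul, mul_one] at this
  have hΨ : ∀ s t, ‖(g t - G t) - (g s - G s)‖ ≤ 2 * c * ‖G t - G s‖ := by
    intro s t
    obtain ⟨k, hk⟩ := exists_int_abs_sub_le ha hb hab hG s t
    have h1 := h s (t - k)
    rw [hshift hloop.per, hshift hGper] at h1
    have e : t - k - s = t - s - k := by ring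
    rw [e] at h1
    refine h1.trans ?_
    have := mul_le_mul_of_nonneg_left hk c.coe_nonneg
    linarith
  have hcr : 2 * (c : ℝ) < 1 := by exact_mod_cast hc
  refine ⟨fun s hs t ht hst => ?_, ?_⟩
  · have hgs : g s = g t := by
      have e : ∀ r ∈ Ico (0 : ℝ) 1, g r = γ r := fun r hr => by
        rw [hg, perExt, Int.fract_eq_self.2 ⟨hr.1, hr.2⟩]
      rw [e s hs, e t ht, hst]
    have h1 := hΨ s t
    have e : (g t - G t) - (g s - G s) = -(G t - G s) := by rw [hgs]; abel
    rw [e, norm_neg] at h1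
    have h2 : ‖G t - G s‖ = 0 := by
      have := norm_nonneg (G t - G s)
      nlinarith
    obtain ⟨k, hk⟩ := exists_int_abs_sub_le ha hb hab hG s t
    rw [h2, mul_zero] at hk
    have h3 : t - s = k := by
      have := abs_nonpos_iff.1 hk
      linarith
    have h4 : (k : ℝ) < 1 := by rw [← h3]; linarith [hs.1, ht.2]
    have h5 : (-1 : ℝ) < k := by rw [← h3]; linarith [hs.2, ht.1]
    have h6 : k < 1 := by exact_mod_cast h4
    have h7 : -1 < k := by exact_mod_cast h5
    have h8 : k = 0 := by omega
    rw [h8, Int.cast_zero] at h3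
    linarith
  -- The displacement as a function of the point of the circle. The choice of parameter is
  -- immaterial, since g - G takes equal values where G does.
  · set Φ : E3 → E3 := fun x => g (Function.invFun G x) - G (Function.invFun G x) with hΦ
    have hinv : ∀ t, G (Function.invFun G (G t)) = G t := fun t =>
      Function.invFun_eq ⟨t, rfl⟩
    have hLip : LipschitzOnWith (2 * c) Φ (range G) := by
      refine LipschitzOnWith.of_dist_le_mul ?_
      rintro _ ⟨t, rfl⟩ _ ⟨s, rfl⟩
      rw [dist_eq_norm, dist_eq_norm]
      have := hΨ (Function.invFun G (G s)) (Function.invFun G (G t))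
      rw [hinv, hinv] at this
      simpa [hΦ, hinv] using this
    have himg : (fun x => x + Φ x) '' range G = trace γ := by
      rw [← range_perExt hγ.closed, ← range_comp, ← hg]
      congr 1
      ext1 t
      have h1 := hΨ t (Function.invFun G (G t))
      rw [hinv, sub_self, norm_zero, mul_zero, norm_le_zero_iff, sub_eq_zero] at h1
      simp only [Function.comp, hΦ, hinv]
      rw [h1]
      abel
    have h1 := (ambientIsotopic_of_lipschitzOnWith hc' hLip).symm
    rw [himg] at h1
    refine h1.trans ?_
    have h2 : range G = range fun t : ℝ => q + Real.cos t • a + Real.sin t • b := by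
      ext x
      constructor
      · rintro ⟨t, rfl⟩
        exact ⟨2 * Real.pi * t, (hG t).symm⟩
      · rintro ⟨t, rfl⟩
        refine ⟨t / (2 * Real.pi), ?_⟩
        have : 2 * Real.pi * (t / (2 * Real.pi)) = t := by field_simp
        rw [hG, this]
    rw [h2]
    exact ambientIsotopic_roundCircle_of_range (by positivity) ha hb hab

theorem exists_pos_rpow_le (K D₀ : ℝ) {c : ℝ} (hD₀ : 0 < D₀) (hc : 0 < c) {α : ℝ} (hα : 0 < α) :
    ∃ D, 0 < D ∧ D ≤ D₀ ∧ K * D ^ α ≤ c := by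
  have h : Continuous fun r : ℝ => K * r ^ α :=
    continuous_const.mul (continuous_id.rpow_const fun _ => Or.inr hα.le)
  have ht := h.tendsto 0
  rw [Real.zero_rpow hα.ne', mul_zero] at ht
  have h1 : ∀ᶠ r in 𝓝[>] (0 : ℝ), K * r ^ α < c :=
    (ht.mono_left nhdsWithin_le_nhds).eventually (Iio_mem_nhds hc)
  have h2 : ∀ᶠ r in 𝓝[>] (0 : ℝ), r < D₀ := nhdsWithin_le_nhds (Iio_mem_nhds hD₀)
  obtain ⟨D, ⟨hD1, hD2⟩, hD⟩ := ((h1.and h2).and self_mem_nhdsWithin).exists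
  exact ⟨D, hD, hD2.le, hD1.le⟩

/-! ### Conclusion: contradiction along a sequence of exponents -/

theorem mainTheorem11 :
    ∃ p₀ : ℝ, 0 < p₀ ∧ ∀ p : ℝ, p₀ ≤ p → ∀ γ : ℝ → E3, IsMengerMinimizer p γ → IsUnknot γ := by
  by_contra! hcon
  -- The summand n sends the exponents to infinity; 24 makes the uniform curvature bound available
  -- for every n.
  have hcon' : ∀ n : ℕ, ∃ p : ℝ, (n : ℝ) + 24 ≤ p ∧ ∃ γ : ℝ → E3, IsMengerMinimizer p γ ∧
      ¬IsUnknot γ := fun n => hcon _ (by positivity)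
  choose p hp γ hmin hnot using hcon'
  have hp24 : ∀ n, 24 ≤ p n := fun n => le_trans (by simp) (hp n)
  have hp0 : ∀ n, 0 < p n := fun n => lt_of_lt_of_le (by norm_num) (hp24 n)
  have hloop : ∀ n, IsUnitLoop (γ n) := fun n => (hmin n).1
  have hE := fun n => (hmin n).energy_le (hp0 n)
  set g : ℕ → ℝ → E3 := fun n => perExt (γ n) with hg
  have hgl : ∀ n, IsLoop (g n) := fun n => (hloop n).isLoop_perExt
  have hr : ∀ n, range (g n) = trace (γ n) := fun n => range_perExt (hloop n).closed
  obtain ⟨D₀, hD₀, hD₀1, hD₀M⟩ := exists_pos_rpow_le (24 * 26) (1 / 2) (c := 1 / 2) (by norm_num)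
    (by norm_num) (α := 3 / 4) (by norm_num)
  have hflat : ∀ n, IsFlat (576 * 26 ^ 2) D₀ (g n) := fun n => by
    refine (hgl n).isFlat (by norm_num) ?_ (by linarith) hD₀M
    intro x hx y hy z hz d hd h1 h2 h3
    rw [hr n] at hx hy hz
    exact kap_le_of_energy (hloop n) (hp24 n) (hE n) hx hy hz hd h1 h2 h3
  have hbd : ∀ n t, ‖g n t‖ ≤ 1 := fun n t => by
    have h0 : (0 : E3) ∈ range (g n) := by rw [hr n]; exact (hloop n).origin_mem
    simpa using (hgl n).norm_sub_le_one (x := g n t) ⟨t, rfl⟩ h0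
  obtain ⟨U, G, hU, hlim⟩ := exists_ultrafilter_limit hbd
  have hκ : KapLeTwoPi G := by
    refine kapLeTwoPi_of_tendsto hlim fun ε hε d hd => ?_
    obtain ⟨P, hP⟩ := exists_kap_le_of_energy hε hd
    obtain ⟨N, hN⟩ := exists_nat_ge P
    refine hU ((eventually_ge_atTop N).mono fun n hn s t u h1 h2 h3 => ?_)
    have hm : ∀ t, g n t ∈ trace (γ n) := fun t => hr n ▸ ⟨t, rfl⟩
    have hn' : (N : ℝ) ≤ n := by exact_mod_cast hn
    exact hP (p n) (by linarith [hp n]) (hp0 n) (γ n) (hloop n) (hE n) _ (hm s) _ (hm t) _ (hm u)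
      h1 h2 h3
  have hlip := fun n => (hgl n).lip
  have hper := fun n => (hgl n).per
  have hGl := lip_of_tendsto hlim hlip
  have hGf := isFlat_of_tendsto hlim hflat
  obtain ⟨q, a, b, ha, hb, hab, hGeq⟩ :=
    hGf.eq_circle (by norm_num) hD₀ hGl (periodic_of_tendsto hlim hper) hκ
  -- Small enough for both requirements: 2c < 1 for injectivity, and 2c times the extension constant
  -- below 1 for the isotopy.
  set c : NNReal := (4 * (lipschitzExtensionConstant E3 + 1))⁻¹ with hc
  have hc0 : 0 < c := by positivity
  have hcmul : c * (4 * (lipschitzExtensionConstant E3 + 1)) = 1 :=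
    inv_mul_cancel₀ (by positivity)
  -- The window is fixed first so that σ = c/8 is admissible, and only then the uniform error μ =
  -- cD/4; together 4σ + 2μ/D = c.
  obtain ⟨D, hD, hDD, hDK⟩ := exists_pos_rpow_le (2 * (576 * 26 ^ 2)) D₀ (c := ((c : ℝ) / 8) ^ 2) hD₀
    (by positivity) (α := 3 / 2) (by norm_num)
  have hμ : 0 < (c : ℝ) * D / 4 := by positivity
  obtain ⟨n, hn⟩ := (uniform_of_tendsto hlim hlip hper hμ).exists
  have hclose := (hflat n).lipschitz_sub hGf (hlip n) hGl hD hDD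
    (show 0 ≤ (c : ℝ) / 8 by positivity) (by linarith) hn
  have hcc : 4 * ((c : ℝ) / 8) + 2 * (c * D / 4 / D) = c := by field_simp; norm_num
  rw [hcc] at hclose
  refine hnot n (isUnknot_of_close (hloop n) ha hb hab hGeq (c := c) ?_ ?_ hclose)
  · rw [← hcmul, mul_comm 2 c]
    refine mul_lt_mul_of_pos_left ?_ hc0
    have h0 : (0 : NNReal) ≤ lipschitzExtensionConstant E3 := zero_le
    exact_mod_cast (show (2 : ℝ) < 4 * (lipschitzExtensionConstant E3 + 1) by
      have : (0 : ℝ) ≤ lipschitzExtensionConstant E3 := NNReal.coe_nonneg _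
      linarith)
  · rw [← hcmul, mul_comm, mul_comm 2 c, mul_assoc]
    refine mul_lt_mul_of_pos_left ?_ hc0
    exact_mod_cast (show (2 : ℝ) * lipschitzExtensionConstant E3 <
      4 * (lipschitzExtensionConstant E3 + 1) by
      have : (0 : ℝ) ≤ lipschitzExtensionConstant E3 := NNReal.coe_nonneg _
      linarith)
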